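/- A \emph{fan} is a connected acyclic simple graph with a distinguished vertex, the root, such that every other vertex has degree at most $2$. The tree order on a fan is $s\preceq t$ iff $s$ lies on the path from the root to $t$; a branch is a maximal $\preceq$-chain. Let $\mathcal F_<$ be the family of all finite discrete structures $(A,R^A,S^A)$ where $A$ is a finite fan all of whose branches have the same height (number of edges), $R^A(s,t)$ holds iff $s=t$ or $t$ is an immediate $\preceq$-successor of $s$, and, for some linear ordering $a_1<\dots<a_n$ of the branches of $A$, $S^A(x,y)$ holds iff there are $i\le j$ with $x\in a_i$ and $y\in a_j$. A topological $\{R,S\}$-structure is a compact Hausdorff zero-dimensional second-countable space with two closed binary relations $R$ and $S$. An epimorphism $\varphi\colon B\to A$ of such structures is a continuous surjection such that, for each of the two relations $T\in\{R,S\}$ and all $x_1,x_2\in A$, $T^A(x_1,x_2)$ holds iff there are $y_1,y_2\in B$ with $\varphi(y_i)=x_i$ and $T^B(y_1,y_2)$; an isomorphism is a bijective epimorphism. Let $\mathbb L_<=(\mathbb L,R^{\mathbb L},S^{\mathbb L})$ be the projective Fra\"iss\'e limit of $\mathcal F_<$, that is, a topological $\{R,S\}$-structure such that (L1) every $A\in\mathcal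 F_<$ is the image of an epimorphism from $\mathbb L_<$; (L2) every continuous map from $\mathbb L$ to a finite discrete space factors through an epimorphism from $\mathbb L_<$ onto some $A\in\mathcal F_<$; (L3) for every $A\in\mathcal F_<$ and all epimorphisms $\varphi_1,\varphi_2\colon\mathbb L_<\to A$ there is an isomorphism $\psi\colon\mathbb L_<\to\mathbb L_<$ with $\varphi_2=\varphi_1\circ\psi$. Let $R^{\mathbb L}_S$ be the symmetrization of $R^{\mathbb L}$, let $L$ be the quotient space $\mathbb L/R^{\mathbb L}_S$ or any space identified with it by a homeomorphism (a model of the Lelek fan), and let $\pi\colon\mathbb L\to L$ be the projection. Let $H(L)$ be the group of all homeomorphisms of $L$ with the compact-open topology, let $\mathrm{Aut}(\mathbb L_<)$ be the group of all homeomorphisms of $\mathbb L$ that preserve $R^{\mathbb L}$ and $S^{\mathbb L}$ in both directions, and for $h\in\mathrm{Aut}(\mathbb L_<)$ let $\pi^*(h)=h^*\in H(L)$ be the induced homeomorphism, so that $h^*\circ\pi=\pi\circ h$. Let $\leq_L$ be the relation $\pi(S^{\mathbb L})$ on $L$, that is, $x\leq_L y$ iff $x=\pi(s)$ and $y=\pi(t)$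 for some $s,t$ with $S^{\mathbb L}(s,t)$. Put $$H=\overline{\pi^*(\mathrm{Aut}(\mathbb L_<))}^{\,H(L)},\qquad H(L_<)=\{h\in H(L):\ x\leq_L y\implies h(x)\leq_L h(y)\ \text{ for all } x,y\in L\}.$$ \textbf{Proposition.} $H=H(L_<)$, and this set is a subgroup of $H(L)$. -/

import Mathlib

open Set Topology

universe u v

namespace LelekFan

/-! ### Structures in the language `{R, S}` of two binary relation symbols -/

/-- An interpretation on `X` of the two binary relation symbols `R` and `S`. -/
class RS (X : Type u) where
  R : X → X → Prop
  S : X → X → Prop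

/-- A topological structure in the language `{R, S}`: a compact (Hausdorff) zero-dimensional
second-countable space with closed interpretations of `R` and `S`.  For compact Hausdorff spaces,
zero-dimensional is the same as totally disconnected. -/
structure IsTopologicalStructure (X : Type u) [TopologicalSpace X] [RS X] : Prop where
  compact : CompactSpace X
  hausdorff : T2Space X
  zeroDimensional : TotallyDisconnectedSpace X
  secondCountable : SecondCountableTopology X
  isClosed_R : IsClosed {p : X × X | RS.R p.1 p.2}
  isClosed_S : IsClosed {p : X × X | RS.S p.1 p.2}

/-- Epimorphisms: continuous surjections such that a relation holds between two points of the
target if and only if it holds between some two preimages of them. -/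
structure IsEpimorphism {Y : Type u} {X : Type v} [TopologicalSpace Y] [RS Y]
    [TopologicalSpace X] [RS X] (φ : Y → X) : Prop where
  continuous : Continuous φ
  surjective : Function.Surjective φ
  map_R : ∀ x₁ x₂ : X, RS.R x₁ x₂ ↔ ∃ y₁ y₂ : Y, φ y₁ = x₁ ∧ φ y₂ = x₂ ∧ RS.R y₁ y₂
  map_S : ∀ x₁ x₂ : X, RS.S x₁ x₂ ↔ ∃ y₁ y₂ : Y, φ y₁ = x₁ ∧ φ y₂ = x₂ ∧ RS.S y₁ y₂

/-- Isomorphisms: bijective epimorphisms. -/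
def IsIsomorphism {Y : Type u} {X : Type v} [TopologicalSpace Y] [RS Y]
    [TopologicalSpace X] [RS X] (φ : Y → X) : Prop :=
  IsEpimorphism φ ∧ Function.Bijective φ

/-- A finite structure in the language `{R, S}`, always carrying the discrete topology. -/
structure FiniteStructure where
  carrier : Type
  finite : Finite carrier
  rs : RS carrier

instance : CoeSort FiniteStructure Type := ⟨FiniteStructure.carrier⟩

instance (A : FiniteStructure) : Finite A := A.finite

instance (A : FiniteStructure) : RS A := A.rs

instance (A : FiniteStructure) : TopologicalSpace A := ⊥

instance (A : FiniteStructure) : DiscreteTopology A := ⟨rfl⟩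

/-- `X` is a projective Fraïssé limit of the family `𝒢` of finite structures. -/
structure IsProjectiveFraisseLimit (𝒢 : Set FiniteStructure) (X : Type u)
    [TopologicalSpace X] [RS X] : Prop where
  isTopologicalStructure : IsTopologicalStructure X
  /-- Projective universality. -/
  universal : ∀ A ∈ 𝒢, ∃ φ : X → A, IsEpimorphism φ
  /-- Continuous maps to finite discrete spaces factor through epimorphisms onto members
  of `𝒢`. -/
  factor : ∀ (Y : Type) [Finite Y] [TopologicalSpace Y] [DiscreteTopology Y] (f : X → Y),
    Continuous f → ∃ A ∈ 𝒢, ∃ φ : X → A, IsEpimorphism φ ∧ ∃ f₀ : A → Y, f = f₀ ∘ φ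
  /-- Projective ultrahomogeneity. -/
  ultrahomogeneous : ∀ A ∈ 𝒢, ∀ φ₁ φ₂ : X → A, IsEpimorphism φ₁ → IsEpimorphism φ₂ →
    ∃ ψ : X → X, IsIsomorphism ψ ∧ φ₂ = φ₁ ∘ ψ

/-! ### Finite fans with ordered branches -/

section Fans

variable {V : Type}

/-- A fan with root `r`: an acyclic connected graph in which every vertex other than `r` has
degree at most two. -/
def IsFan (G : SimpleGraph V) (r : V) : Prop :=
  G.IsTree ∧ ∀ v : V, v ≠ r → (G.neighborSet v).encard ≤ 2

/-- The tree order: `s` lies on the path connecting the root `r` and `t`. -/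
def TreeLE (G : SimpleGraph V) (r s t : V) : Prop :=
  ∃ p : G.Walk r t, p.IsPath ∧ s ∈ p.support

/-- `t` is an immediate successor of `s` in the tree order. -/
def IsImmediateSuccessor (G : SimpleGraph V) (r s t : V) : Prop :=
  TreeLE G r s t ∧ s ≠ t ∧ ∀ p : V, TreeLE G r s p → TreeLE G r p t → p = s ∨ p = t

/-- Branches are maximal chains of the tree order. -/
def IsBranch (G : SimpleGraph V) (r : V) (b : Set V) : Prop :=
  IsMaxChain (TreeLE G r) b

/-- `(V, R, S)` is a fan, all of whose branches have the same height, where `R s t` means that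
`s = t` or `t` is an immediate successor of `s`, and where for some enumeration
`a 0 < a 1 < ⋯ < a (n - 1)` of the branches, without repetition, `S x y` means that `x ∈ a i` and
`y ∈ a j` for some `i ≤ j`. -/
def IsOrderedFan (V : Type) [RS V] : Prop :=
  ∃ (G : SimpleGraph V) (r : V), IsFan G r ∧
    (∃ k : ℕ, ∀ b : Set V, IsBranch G r b → b.encard = k + 1) ∧
    (∀ s t : V, RS.R s t ↔ s = t ∨ IsImmediateSuccessor G r s t) ∧
    ∃ (n : ℕ) (a : Fin n → Set V), Function.Injective a ∧
      (∀ b : Set V, IsBranch G r b ↔ b ∈ range a) ∧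
      ∀ x y : V, RS.S x y ↔ ∃ i j : Fin n, i ≤ j ∧ x ∈ a i ∧ y ∈ a j

end Fans

/-- The family of all finite fans with all branches of the same height, expanded by the relations
`S` that come from linear orders of the branches. -/
def orderedFans : Set FiniteStructure := {A | IsOrderedFan A}

/-! ### Automorphisms, the quotient space, and the induced homeomorphisms -/

section Quotient

variable {X : Type u} [TopologicalSpace X] [RS X]

/-- The automorphism group: all homeomorphisms that preserve `R` and `S` in both directions. -/
def Aut (X : Type u) [TopologicalSpace X] [RS X] : Subgroup (X ≃ₜ X) where
  carrier := {h | (∀ x y : X, RS.R (h x) (h y) ↔ RS.R x y) ∧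
    ∀ x y : X, RS.S (h x) (h y) ↔ RS.S x y}
  one_mem' := ⟨fun _ _ => Iff.rfl, fun _ _ => Iff.rfl⟩
  mul_mem' := fun {f g} hf hg =>
    ⟨fun x y => (hf.1 (g x) (g y)).trans (hg.1 x y),
      fun x y => (hf.2 (g x) (g y)).trans (hg.2 x y)⟩
  inv_mem' := fun {f} hf => by
    refine ⟨fun x y => ?_, fun x y => ?_⟩
    · have h := hf.1 (f.symm x) (f.symm y)
      simp only [Homeomorph.apply_symm_apply] at h
      exact h.symm
    · have h := hf.2 (f.symm x) (f.symm y)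
      simp only [Homeomorph.apply_symm_apply] at h
      exact h.symm

/-- The symmetrization of `R`. -/
def RSymm (x y : X) : Prop := RS.R x y ∨ RS.R y x

/-- The quotient of `X` by the symmetrization of `R`, with the quotient topology. -/
abbrev FanQuotient (X : Type u) [TopologicalSpace X] [RS X] : Type u := Quot (RSymm (X := X))

variable {L : Type v} [TopologicalSpace L]

/-- The natural projection `X → X / RSymm ≅ L`. -/
def proj (e : FanQuotient X ≃ₜ L) (x : X) : L := e (Quot.mk _ x)

/-- The homeomorphism `h*` of `L` induced by an automorphism `h`;
it satisfies `h* ∘ proj e = proj e ∘ h`. -/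
def inducedHomeo (e : FanQuotient X ≃ₜ L) (h : Aut X) : L ≃ₜ L :=
  e.symm.trans ((Homeomorph.Quot.congr h.1
    fun x y => (or_congr (h.2.1 x y) (h.2.1 y x)).symm).trans e)

theorem inducedHomeo_proj (e : FanQuotient X ≃ₜ L) (h : Aut X) (x : X) :
    inducedHomeo e h (proj e x) = proj e (h.1 x) := by
  simp only [inducedHomeo, proj, Homeomorph.trans_apply, Homeomorph.symm_apply_apply]
  rfl

/-- The relation `≤_L` on `L`, the image of `S` under the projection. -/
def le (e : FanQuotient X ≃ₜ L) (x y : L) : Prop :=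
  ∃ s t : X, RS.S s t ∧ proj e s = x ∧ proj e t = y

/-- The compact-open topology on the homeomorphism group of `L`. -/
instance homeoCompactOpen (L : Type v) [TopologicalSpace L] : TopologicalSpace (L ≃ₜ L) :=
  TopologicalSpace.induced (fun h : L ≃ₜ L => (h : C(L, L))) ContinuousMap.compactOpen

/-- The closure, in the homeomorphism group of `L`, of the set of all homeomorphisms induced by
automorphisms. -/
def closureAut (e : FanQuotient X ≃ₜ L) : Set (L ≃ₜ L) := closure (range (inducedHomeo e))

/-- The homeomorphisms of `L` that preserve `≤_L`. -/
def orderPreserving (e : FanQuotient X ≃ₜ L) : Set (L ≃ₜ L) :=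
  {h | ∀ x y : L, le e x y → le e (h x) (h y)}

end Quotient

end LelekFan

/-!
The proof works with the epimorphisms from the limit `X` onto the finite ordered fans. Every finite
ordered fan is isomorphic to a standard one, `StdFan n k`, with `n` branches of height `k`
(`IsOrderedFan.exists_iso`, `StdFan.isOrderedFan`), so that only these occur later on. The
epimorphisms onto standard fans are directed under refinement, separate the points of `X` and
determine `R` and `S`; together with compactness (`exists_forall_mem`) this transfers
statements about finite fans to `X`. In particular `X` has a root and a tree order `Below`.
By projective ultrahomogeneity, epimorphisms lift along epimorphisms of standard fans
(`exists_lift`), and two such liftings give what is needed beyond that. Lifting along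
`StdFan.halve`, which doubles each vertex, shows that the symmetrization of `R` is an equivalence
relation whose classes have at most two points and that the class of the root is a singleton;
hence `L` is Hausdorff, and `S` descends to `≤_L`. Lifting along `StdFan.truncate`, which adds
truncated copies of the branches, makes every vertex of a given fan the image of an end.

The homeomorphisms that preserve `≤_L` form a closed set that contains those induced by
automorphisms. Let `h` be one of them. It fixes the root, since the root is the only point related
by `≤_L` to all points in both directions. It preserves the tree order of `L` in both directions,
since `p` is below `q` if and only if every closed connected set containing the root and `q`
contains `p` (`belowL_iff`). As two points that are related by `≤_L` in both directions are
comparable in the tree order, and `≤_L` is total, the inverse of `h` preserves `≤_L` as well.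

To approximate `h` by an automorphism (`exists_aut_close`), let `φ : X → A` be an epimorphism
whose fibres have small images in `L`, and let `θ : X → B` be an epimorphism with fibres much
smaller still. Along each branch of `B`, pick points of a chain of `X`, one over each vertex `b`,
map them to `L`, apply `h`, and send `b` to the vertex of `A` under the lowest representative of the
result. The resulting map `α : B → A` preserves the root and `S` because `h` preserves the root and
`≤_L`. It preserves `R` because it is monotone for the tree orders, while the images of neighbours
are equal or adjacent, as the corresponding pieces of `L` intersect. It reaches the ends of `A`
by the choice of `B`, so it is an epimorphism. Ultrahomogeneity gives an automorphism `f` with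
`α ∘ θ = φ ∘ f`, and the homeomorphism induced by `f` is close to `h`.
-/

namespace LelekFan

/-! ### Standard ordered fans -/

/-- The vertices of the standard ordered fan with `n` branches of height `k`; besides the root,
the `i`-th branch consists of the vertices `node i j`, where `node i j` has height `j + 1`. -/
inductive StdFan (n k : ℕ) : Type
  | root : StdFan n k
  | node (i : Fin n) (j : Fin k) : StdFan n k

namespace StdFan

variable {n k m l : ℕ}

instance : RS (StdFan n k) where
  R x y := match x, y with
    | root, root => True
    | root, node _ j => j.val = 0
    | node _ _, root => False
    | node i j, node i' j' => i = i' ∧ (j'.val = j.val ∨ j'.val = j.val + 1)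
  S x y := match x, y with
    | node i _, node i' _ => i ≤ i'
    | root, _ => True
    | node _ _, root => True

/-- The tree order of the standard fan. -/
def Le (x y : StdFan n k) : Prop := match x, y with
  | root, _ => True
  | node _ _, root => False
  | node i j, node i' j' => i = i' ∧ j.val ≤ j'.val

instance : TopologicalSpace (StdFan n k) := ⊥

instance : DiscreteTopology (StdFan n k) := ⟨rfl⟩

instance : Finite (StdFan n k) :=
  Finite.of_surjective (fun o : Option (Fin n × Fin k) => o.elim root fun p => node p.1 p.2) (by
    rintro (_ | ⟨i, j⟩)
    · exact ⟨none, rfl⟩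
    · exact ⟨some (i, j), rfl⟩)

@[simp] theorem R_root_root : RS.R (root : StdFan n k) root ↔ True := Iff.rfl
@[simp] theorem R_root_node {i : Fin n} {j : Fin k} : RS.R root (node i j) ↔ j.val = 0 := Iff.rfl
@[simp] theorem R_node_root {i : Fin n} {j : Fin k} : RS.R (node i j) root ↔ False := Iff.rfl
@[simp] theorem R_node_node {i i' : Fin n} {j j' : Fin k} :
    RS.R (node i j) (node i' j') ↔ i = i' ∧ (j'.val = j.val ∨ j'.val = j.val + 1) := Iff.rfl
@[simp] theorem S_root_left {y : StdFan n k} : RS.S root y ↔ True := by cases y <;> exact Iff.rfl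
@[simp] theorem S_root_right {x : StdFan n k} : RS.S x root ↔ True := by cases x <;> exact Iff.rfl
@[simp] theorem S_node_node {i i' : Fin n} {j j' : Fin k} :
    RS.S (node i j) (node i' j') ↔ i ≤ i' := Iff.rfl
@[simp] theorem Le_root {y : StdFan n k} : Le root y ↔ True := Iff.rfl
@[simp] theorem Le_node_root {i : Fin n} {j : Fin k} : Le (node i j) root ↔ False := Iff.rfl
@[simp] theorem Le_node_node {i i' : Fin n} {j j' : Fin k} :
    Le (node i j) (node i' j') ↔ i = i' ∧ j.val ≤ j'.val := Iff.rfl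

theorem R_refl (x : StdFan n k) : RS.R x x := by cases x <;> simp

theorem S_total (x y : StdFan n k) : RS.S x y ∨ RS.S y x := by
  cases x <;> cases y <;> simp [le_total]

theorem Le.refl (x : StdFan n k) : Le x x := by cases x <;> simp

theorem Le.trans {x y z : StdFan n k} (h : Le x y) (h' : Le y z) : Le x z := by
  cases x <;> cases y <;> cases z <;> first | trivial | exact h.elim | exact h'.elim | skip
  exact ⟨h.1.trans h'.1, h.2.trans h'.2⟩

theorem Le.antisymm {x y : StdFan n k} (h : Le x y) (h' : Le y x) : x = y := by
  cases x <;> cases y <;> simp_all [Fin.ext_iff]; omega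

theorem Le.total_of_le {x y z : StdFan n k} (h : Le x z) (h' : Le y z) : Le x y ∨ Le y x := by
  cases x <;> cases y <;> cases z <;> simp_all; omega

theorem Le.S {x y : StdFan n k} (h : Le x y) : RS.S x y ∧ RS.S y x := by
  cases x <;> cases y <;> simp_all

theorem Le_or_of_S {x y : StdFan n k} (h : RS.S x y) (h' : RS.S y x) : Le x y ∨ Le y x := by
  cases x <;> cases y <;> simp_all
  rw [le_antisymm h h']
  simp [le_total]

theorem Le_of_R {x y : StdFan n k} (h : RS.R x y) : Le x y := by
  cases x <;> cases y <;> simp_all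
  omega

theorem Le.R_of_RSymm {x y : StdFan n k} (h : Le x y) (h' : RSymm x y) : RS.R x y := by
  rcases h' with h' | h'
  · exact h'
  · rw [h.antisymm (Le_of_R h')]
    exact R_refl _

/-- A vertex strictly below `y` lies below the immediate predecessor of `y`. -/
theorem Le.eq_or_le_of_R {x y z : StdFan n k} (h : Le x z) (hR : RS.R y z) : x = z ∨ Le x y := by
  cases x <;> cases y <;> cases z <;> simp_all [Fin.ext_iff] <;> omega

/-- The only edge that enters the set of vertices above `a` joins `a` with its predecessor. -/
theorem eq_of_RSymm_of_le {a x y : StdFan n k} (h : RSymm x y) (hx : Le a x) (hy : ¬ Le a y) :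
    x = a := by
  rcases h with h | h
  · exact absurd (hx.trans (Le_of_R h)) hy
  · rcases hx.eq_or_le_of_R h with h' | h'
    · exact h'.symm
    · exact absurd h' hy

/-- Neighbours other than the root lie on the same branch. -/
theorem S_congr_of_RSymm {x x' y : StdFan n k} (h : RSymm x x') (hx : x ≠ root)
    (hx' : x' ≠ root) : (RS.S x y ↔ RS.S x' y) ∧ (RS.S y x ↔ RS.S y x') := by
  cases x <;> cases x' <;> cases y <;> simp_all [RSymm]
  rcases h with h | h <;> simp [h.1]

/-- An edge in the image of the chain below `b`, under a map that preserves the root and `R`,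
lifts to an edge in that chain: such a map climbs the chain by steps of at most one. -/
theorem exists_lift {f : StdFan m l → StdFan n k} (h0 : f root = root)
    (hR : ∀ x y, RS.R x y → RS.R (f x) (f y)) {a a' : StdFan n k} (h : RS.R a a')
    {b : StdFan m l} (hb : Le a' (f b)) :
    ∃ c c', RS.R c c' ∧ Le c' b ∧ f c = a ∧ f c' = a' := by
  have step : ∀ b₀ b : StdFan m l, RS.R b₀ b →
      (Le a' (f b₀) → ∃ c c', RS.R c c' ∧ Le c' b₀ ∧ f c = a ∧ f c' = a') → Le a' (f b) →
      ∃ c c', RS.R c c' ∧ Le c' b ∧ f c = a ∧ f c' = a' := by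
    intro b₀ b hR₀ ih hb
    by_cases h₀ : Le a' (f b₀)
    · obtain ⟨c, c', h1, h2, h3⟩ := ih h₀
      exact ⟨c, c', h1, h2.trans (Le_of_R hR₀), h3⟩
    · have h1 := hR _ _ hR₀
      have h2 : a' = f b := (hb.eq_or_le_of_R h1).resolve_right h₀
      subst h2
      rcases (Le_of_R h).eq_or_le_of_R h1 with h3 | h3
      · exact ⟨b, b, R_refl b, Le.refl b, h3.symm, rfl⟩
      · refine ⟨b₀, b, hR₀, Le.refl b, ?_, rfl⟩
        rcases (Le_of_R h1).eq_or_le_of_R h with h4 | h4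
        · exact absurd (h4 ▸ Le.refl _) h₀
        · exact h4.antisymm h3
  have base : Le a' (f root) →
      ∃ c c', RS.R c c' ∧ Le c' (root : StdFan m l) ∧ f c = a ∧ f c' = a' := by
    intro hb
    rw [h0] at hb
    have h1 : a' = root := hb.antisymm trivial
    subst h1
    have h2 : a = root := (Le_of_R h).antisymm trivial
    exact ⟨root, root, trivial, trivial, by rw [h0, h2], h0⟩
  rcases b with _ | ⟨i, ⟨j, hj⟩⟩
  · exact base hb
  · induction j with
    | zero => exact step root _ rfl base hb
    | succ j ih => exact step (node i ⟨j, by omega⟩) _ ⟨rfl, Or.inr rfl⟩ (ih _) hb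

theorem map_Le {f : StdFan m l → StdFan n k} (hR : ∀ x y, RS.R x y → RS.R (f x) (f y))
    (h0 : f root = root) {x y : StdFan m l} (h : Le x y) : Le (f x) (f y) := by
  rcases x with _ | ⟨i, j⟩
  · rw [h0]; trivial
  rcases y with _ | ⟨i', ⟨j', hj'⟩⟩
  · exact h.elim
  obtain ⟨rfl, h⟩ := h
  induction j' with
  | zero =>
    rw [show j = ⟨0, hj'⟩ from Fin.ext (Nat.le_zero.1 h)]
    exact Le.refl _
  | succ j' ih =>
    rcases Nat.of_le_succ h with h | h
    · exact (ih (by omega) h).trans (Le_of_R (hR _ _ ⟨rfl, Or.inr rfl⟩))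
    · rw [show j = ⟨j' + 1, hj'⟩ from Fin.ext h]
      exact Le.refl _

/-- A map of standard fans that preserves the root, `R` and `S`, and that reaches the end of each
branch, is an epimorphism. -/
theorem isEpimorphism_of_ends (hk : 0 < k) {f : StdFan m l → StdFan n k}
    (h0 : f root = root)
    (hR : ∀ x y, RS.R x y → RS.R (f x) (f y)) (hS : ∀ x y, RS.S x y → RS.S (f x) (f y))
    (hend : ∀ (i : Fin n) (j : Fin k), j.val + 1 = k → ∃ x, f x = node i j) :
    IsEpimorphism f := by
  have habove : ∀ a, ∃ b, Le a (f b) := by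
    rintro (_ | ⟨i, j⟩)
    · exact ⟨root, trivial⟩
    · obtain ⟨b, hb⟩ := hend i ⟨k - 1, by omega⟩ (Nat.sub_add_cancel hk)
      refine ⟨b, hb ▸ ⟨rfl, ?_⟩⟩
      have := j.2
      simp only
      omega
  have hsurj : Function.Surjective f := fun a => by
    obtain ⟨b, hb⟩ := habove a
    obtain ⟨c, -, -, -, hc, -⟩ := exists_lift h0 hR (R_refl a) hb
    exact ⟨c, hc⟩
  refine ⟨continuous_of_discreteTopology, hsurj, fun a a' => ⟨fun h => ?_, ?_⟩,
    fun a a' => ⟨fun h => ?_, ?_⟩⟩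
  · obtain ⟨b, hb⟩ := habove a'
    obtain ⟨c, c', h1, -, h2, h3⟩ := exists_lift h0 hR h hb
    exact ⟨c, c', h2, h3, h1⟩
  · rintro ⟨c, c', rfl, rfl, h⟩
    exact hR _ _ h
  · rcases a with _ | ⟨i, j⟩
    · obtain ⟨c', hc'⟩ := hsurj a'
      exact ⟨root, c', h0, hc', by simp⟩
    rcases a' with _ | ⟨i', j'⟩
    · obtain ⟨c, hc⟩ := hsurj (node i j)
      exact ⟨c, root, hc, h0, by simp⟩
    rcases (show i ≤ i' from h).eq_or_lt with rfl | h
    · obtain ⟨b, hb⟩ := hend i ⟨k - 1, by omega⟩ (Nat.sub_add_cancel hk)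
      have hle : ∀ j : Fin k, Le (node i j) (f b) := fun j => hb ▸ ⟨rfl, by
        have := j.2; simp only; omega⟩
      obtain ⟨-, c, -, h1, -, h2⟩ := exists_lift h0 hR (R_refl _) (hle j)
      obtain ⟨-, c', -, h1', -, h2'⟩ := exists_lift h0 hR (R_refl _) (hle j')
      refine ⟨c, c', h2, h2', ?_⟩
      rcases h1.total_of_le h1' with h3 | h3
      exacts [h3.S.1, h3.S.2]
    · obtain ⟨c, hc⟩ := hsurj (node i j)
      obtain ⟨c', hc'⟩ := hsurj (node i' j')
      refine ⟨c, c', hc, hc', (S_total c c').resolve_right fun h' => ?_⟩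
      have := hS _ _ h'
      rw [hc, hc', S_node_node] at this
      exact absurd h this.not_gt
  · rintro ⟨c, c', rfl, rfl, h⟩
    exact hS _ _ h

/-- The vertex of height `h` on the `i`-th branch; the root if `h = 0`, or if `h` exceeds the
height of the fan. -/
def atHeight (i : Fin n) (h : ℕ) : StdFan n k :=
  if hh : 1 ≤ h ∧ h ≤ k then node i ⟨h - 1, by omega⟩ else root

theorem atHeight_zero (i : Fin n) : (atHeight i 0 : StdFan n k) = root := by simp [atHeight]

theorem atHeight_succ (i : Fin n) (j : Fin k) : atHeight i (j.val + 1) = node i j := by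
  have := j.2
  simp [atHeight]

/-- The map of standard fans that sends the `i`-th branch into the `σ i`-th one, a vertex of
height `h` being sent to one of height `c i h`. -/
def branchMap (σ : Fin m → Fin n) (c : Fin m → ℕ → ℕ) : StdFan m l → StdFan n k
  | root => root
  | node i j => atHeight (σ i) (c i (j.val + 1))

theorem isEpimorphism_branchMap (hk : 0 < k) {σ : Fin m → Fin n} (hσ : Monotone σ)
    {c : Fin m → ℕ → ℕ} (hc0 : ∀ i, c i 0 = 0)
    (hc1 : ∀ i h, c i (h + 1) = c i h ∨ c i (h + 1) = c i h + 1)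
    (hck : ∀ i h, h ≤ l → c i h ≤ k)
    (hend : ∀ i : Fin n, ∃ i' : Fin m, ∃ h < l, σ i' = i ∧ c i' (h + 1) = k) :
    IsEpimorphism (branchMap σ c : StdFan m l → StdFan n k) := by
  refine isEpimorphism_of_ends hk rfl ?_ ?_ ?_
  · have key : ∀ (i : Fin n) (p q : ℕ), q ≤ k → (q = p ∨ q = p + 1) →
        RS.R (atHeight i p : StdFan n k) (atHeight i q) := by
      rintro i p q hq (rfl | rfl)
      · exact R_refl _
      · rw [show p + 1 = (⟨p, hq⟩ : Fin k).val + 1 from rfl, atHeight_succ]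
        rcases p with _ | p
        · rw [atHeight_zero]; rfl
        · have := atHeight_succ i (⟨p, by omega⟩ : Fin k)
          rw [show (⟨p, by omega⟩ : Fin k).val + 1 = p + 1 from rfl] at this
          rw [this]
          exact ⟨rfl, Or.inr rfl⟩
    rintro (_ | ⟨i, j⟩) (_ | ⟨i', j'⟩) h
    · trivial
    · have := key (σ i') 0 (c i' (j'.val + 1)) (hck _ _ j'.2) (by
        have := hc1 i' 0
        rw [show j'.val = 0 from h]
        rwa [hc0 i'] at this)
      rwa [atHeight_zero] at this
    · exact h.elim
    · obtain ⟨rfl, h⟩ := h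
      refine key _ _ _ (hck _ _ j'.2) ?_
      rcases h with h | h
      · exact Or.inl (by rw [h])
      · rw [h]; exact hc1 _ _
  · have key : ∀ (i i' : Fin n) (p q : ℕ), i ≤ i' →
        RS.S (atHeight i p : StdFan n k) (atHeight i' q) := by
      intro i i' p q h
      unfold atHeight
      split_ifs <;> simp [h]
    rintro (_ | ⟨i, j⟩) (_ | ⟨i', j'⟩) h
    · simp [branchMap]
    · simp [branchMap]
    · simp [branchMap]
    · exact key _ _ _ _ (hσ h)
  · intro i j hj
    obtain ⟨i', h, hl, rfl, hh⟩ := hend i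
    refine ⟨node i' ⟨h, hl⟩, ?_⟩
    simp only [branchMap]
    rw [hh, ← atHeight_succ, hj]

/-- The epimorphism that folds every branch in pairs of vertices: `2h` and `2h + 1` are the
heights of the vertices sent to height `h`. -/
def halve : StdFan n (2 * k + 1) → StdFan n k := branchMap id fun _ h => h / 2

theorem isEpimorphism_halve (hk : 0 < k) :
    IsEpimorphism (halve : StdFan n (2 * k + 1) → StdFan n k) :=
  isEpimorphism_branchMap hk monotone_id (by simp) (by intros; omega) (by intros; omega)
    fun i => ⟨i, 2 * k, by omega, rfl, by omega⟩

theorem halve_node {i : Fin n} {j : Fin (2 * k + 1)} {j' : Fin k} :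
    halve (node i j) = node i j' ↔ (j.val + 1) / 2 = j'.val + 1 := by
  simp only [halve, branchMap, atHeight, id]
  have := j'.2
  split_ifs with h
  · simp only [node.injEq, true_and, Fin.ext_iff]; omega
  · simp only [false_iff]; omega

theorem eq_root_of_halve_eq {n k : ℕ} {x y : StdFan n (2 * k + 1)} (hx : x = root)
    (h : RSymm x y) : (halve y : StdFan n k) = root := by
  subst hx
  rcases y with _ | ⟨i, j⟩
  · rfl
  · have hj : j.val = 0 := by rcases h with h | h; exacts [h, h.elim]
    simp [halve, branchMap, hj, atHeight_zero]

/-- A vertex of the finer fan has neighbours over at most one vertex other than its own image. -/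
theorem halve_eq_of_RSymm {x y z : StdFan n (2 * k + 1)} (hxy : RSymm x y) (hyz : RSymm y z)
    (hx : (halve x : StdFan n k) ≠ halve y) (hz : (halve z : StdFan n k) ≠ halve y) :
    (halve x : StdFan n k) = halve z := by
  rcases y with _ | ⟨i, j⟩
  · rw [eq_root_of_halve_eq rfl hxy.symm, eq_root_of_halve_eq rfl hyz]
  have key : ∀ w : StdFan n (2 * k + 1), RSymm w (node i j) →
      (halve w : StdFan n k) ≠ halve (node i j) →
      (halve w : StdFan n k) = atHeight i (if (j.val + 1) % 2 = 0 then (j.val + 1) / 2 - 1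
        else (j.val + 1) / 2 + 1) := by
    intro w hw hne
    rcases w with _ | ⟨i', j'⟩
    · have hj : j.val = 0 := by rcases hw with h | h; exacts [h, h.elim]
      exact absurd (eq_root_of_halve_eq rfl hw).symm hne
    · obtain ⟨rfl, hj⟩ : i' = i ∧ (j.val = j'.val ∨ j.val = j'.val + 1 ∨ j'.val = j.val + 1) := by
        rcases hw with h | h
        · exact ⟨h.1, by have := h.2; omega⟩
        · exact ⟨h.1.symm, by have := h.2; omega⟩
      have hne' : (j'.val + 1) / 2 ≠ (j.val + 1) / 2 := fun h => hne (by
        simp only [halve, branchMap, h])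
      simp only [halve, branchMap, id]
      congr 1
      split_ifs <;> omega
  rw [key x hxy hx, key z hyz.symm hz]

/-- All neighbours of an end of the finer fan lie over the same end. -/
theorem halve_eq_of_RSymm_end {i : Fin n} {j : Fin k} (hj : j.val + 1 = k)
    {j' : Fin (2 * k + 1)} (hj' : j'.val = 2 * k) {y : StdFan n (2 * k + 1)}
    (h : RSymm (node i j') y) : halve y = node i j := by
  rcases y with _ | ⟨i', l⟩
  · rcases h with h | h
    · exact h.elim
    · have : j'.val = 0 := h
      omega
  · have := l.2
    obtain ⟨rfl, hj⟩ : i = i' ∧ (l.val = j'.val ∨ j'.val = l.val + 1) := by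
      rcases h with h | h
      · exact ⟨h.1, by have := h.2; omega⟩
      · exact ⟨h.1.symm, by have := h.2; omega⟩
    rw [halve_node]
    omega

/-- The epimorphism onto a fan from a fan that has, in place of each branch, copies of this
branch truncated at all possible heights. -/
def truncate : StdFan (n * (k + 1)) k → StdFan n k :=
  branchMap Fin.divNat fun i h => min h (Fin.modNat i).val

theorem truncate_node (i : Fin n) (h : ℕ) (hh : h ≤ k) (j : Fin k) (hj : j.val + 1 = k) :
    truncate (node (finProdFinEquiv (i, ⟨h, by omega⟩)) j) = (atHeight i h : StdFan n k) := by
  have h1 := finProdFinEquiv.symm_apply_apply (i, (⟨h, by omega⟩ : Fin (k + 1)))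
  rw [finProdFinEquiv_symm_apply, Prod.mk.injEq] at h1
  simp only [truncate, branchMap]
  rw [h1.1, h1.2, hj]
  simp [hh]

theorem isEpimorphism_truncate (hk : 0 < k) :
    IsEpimorphism (truncate : StdFan (n * (k + 1)) k → StdFan n k) := by
  refine isEpimorphism_branchMap hk ?_ (by simp) (by intros; omega) (by intros; omega) fun i => ?_
  · intro a b h
    exact Nat.div_le_div_right (c := k + 1) h
  · have h1 := finProdFinEquiv.symm_apply_apply (i, Fin.last k)
    rw [finProdFinEquiv_symm_apply, Prod.mk.injEq] at h1
    refine ⟨finProdFinEquiv (i, Fin.last k), k - 1, by omega, h1.1, ?_⟩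
    rw [h1.2]
    simp only [Fin.val_last]
    omega

/-- Every vertex is the image of the end of some branch. -/
theorem exists_end_truncate_eq (hn : 0 < n) (hk : 0 < k) (x : StdFan n k) :
    ∃ (i : Fin (n * (k + 1))) (j : Fin k), j.val + 1 = k ∧ truncate (node i j) = x := by
  rcases x with _ | ⟨i, j⟩
  · exact ⟨_, ⟨k - 1, by omega⟩, Nat.sub_add_cancel hk,
      (truncate_node ⟨0, hn⟩ 0 (Nat.zero_le k) _ (Nat.sub_add_cancel hk)).trans (atHeight_zero _)⟩
  · exact ⟨_, ⟨k - 1, by omega⟩, Nat.sub_add_cancel hk,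
      (truncate_node i (j.val + 1) j.2 _ (Nat.sub_add_cancel hk)).trans (atHeight_succ _ _)⟩

end StdFan


/-! ### Rooted trees and fans -/

section RootedTree

variable {V : Type} {G : SimpleGraph V}

/-- The path from the root of a tree to a vertex. -/
noncomputable def rootPath (hG : G.IsTree) (r t : V) : G.Walk r t :=
  (hG.existsUnique_path r t).choose

theorem rootPath_isPath (hG : G.IsTree) (r t : V) : (rootPath hG r t).IsPath :=
  (hG.existsUnique_path r t).choose_spec.1

theorem eq_rootPath (hG : G.IsTree) (r : V) {t : V} {p : G.Walk r t} (hp : p.IsPath) :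
    p = rootPath hG r t :=
  (hG.existsUnique_path r t).unique hp (rootPath_isPath hG r t)

/-- The height of a vertex of a rooted tree: the length of the path from the root. -/
noncomputable def height (hG : G.IsTree) (r t : V) : ℕ := (rootPath hG r t).length

/-- The vertex of height `j` on the path from the root to `t`. -/
noncomputable def ancestor (hG : G.IsTree) (r t : V) (j : ℕ) : V :=
  (rootPath hG r t).getVert j

theorem ancestor_height (hG : G.IsTree) (r t : V) : ancestor hG r t (height hG r t) = t :=
  SimpleGraph.Walk.getVert_length _

theorem ancestor_zero (hG : G.IsTree) (r t : V) : ancestor hG r t 0 = r :=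
  SimpleGraph.Walk.getVert_zero _

theorem rootPath_ancestor (hG : G.IsTree) (r t : V) (j : ℕ) :
    rootPath hG r (ancestor hG r t j) = (rootPath hG r t).take j :=
  (eq_rootPath hG r ((rootPath_isPath hG r t).take j)).symm

theorem height_ancestor (hG : G.IsTree) (r : V) {t : V} {j : ℕ} (h : j ≤ height hG r t) :
    height hG r (ancestor hG r t j) = j := by
  rw [height, rootPath_ancestor]
  exact (SimpleGraph.Walk.take_length _ _).trans (min_eq_left h)

theorem ancestor_ancestor (hG : G.IsTree) (r : V) {t : V} {i j : ℕ} (h : j ≤ i) :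
    ancestor hG r (ancestor hG r t i) j = ancestor hG r t j := by
  rw [ancestor, rootPath_ancestor]
  refine (SimpleGraph.Walk.take_getVert _ _ _).trans ?_
  rw [min_eq_right h]
  rfl

theorem adj_ancestor (hG : G.IsTree) (r : V) {t : V} {j : ℕ} (h : j < height hG r t) :
    G.Adj (ancestor hG r t j) (ancestor hG r t (j + 1)) :=
  (rootPath hG r t).adj_getVert_succ h

theorem treeLE_iff (hG : G.IsTree) (r : V) {s t : V} :
    TreeLE G r s t ↔ height hG r s ≤ height hG r t ∧ ancestor hG r t (height hG r s) = s := by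
  constructor
  · rintro ⟨p, hp, hs⟩
    obtain rfl := eq_rootPath hG r hp
    obtain ⟨j, rfl, hj⟩ := SimpleGraph.Walk.mem_support_iff_exists_getVert.1 hs
    have h := height_ancestor hG r hj
    rw [ancestor] at h
    rw [h]
    exact ⟨hj, rfl⟩
  · rintro ⟨-, h⟩
    refine ⟨rootPath hG r t, rootPath_isPath hG r t, ?_⟩
    rw [← h]
    exact SimpleGraph.Walk.getVert_mem_support _ _

theorem treeLE_ancestor (hG : G.IsTree) (r : V) {t : V} {j : ℕ} (h : j ≤ height hG r t) :
    TreeLE G r (ancestor hG r t j) t := by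
  rw [treeLE_iff hG, height_ancestor hG r h]
  exact ⟨h, rfl⟩

theorem treeLE_refl (hG : G.IsTree) (r t : V) : TreeLE G r t t :=
  (treeLE_iff hG r).2 ⟨le_rfl, ancestor_height hG r t⟩

theorem treeLE_trans (hG : G.IsTree) (r : V) {s t u : V} (h : TreeLE G r s t)
    (h' : TreeLE G r t u) : TreeLE G r s u := by
  rw [treeLE_iff hG] at *
  refine ⟨h.1.trans h'.1, ?_⟩
  rw [← ancestor_ancestor hG r h.1, h'.2, h.2]

theorem treeLE_of_treeLE (hG : G.IsTree) (r : V) {s s' t : V} (h : TreeLE G r s t)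
    (h' : TreeLE G r s' t) (hh : height hG r s ≤ height hG r s') : TreeLE G r s s' := by
  rw [treeLE_iff hG] at *
  refine ⟨hh, ?_⟩
  rw [← h'.2, ancestor_ancestor hG r hh, h.2]

theorem eq_of_treeLE (hG : G.IsTree) (r : V) {s t : V} (h : TreeLE G r s t)
    (hh : height hG r s = height hG r t) : s = t := by
  rw [treeLE_iff hG] at h
  rw [← h.2, hh, ancestor_height]

theorem isImmediateSuccessor_iff (hG : G.IsTree) (r : V) {s t : V} : IsImmediateSuccessor G r s t ↔
    TreeLE G r s t ∧ height hG r t = height hG r s + 1 := by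
  constructor
  · rintro ⟨h, hne, hmin⟩
    refine ⟨h, ?_⟩
    have h1 := (treeLE_iff hG r).1 h
    have h2 : height hG r s ≠ height hG r t := fun h' => hne (eq_of_treeLE hG r h h')
    have hle : height hG r s + 1 ≤ height hG r t := by omega
    have h3 := height_ancestor hG r hle
    have h4 := treeLE_ancestor hG r hle
    rcases hmin _ (treeLE_of_treeLE hG r h h4 (by omega)) h4 with h5 | h5
    · rw [h5] at h3; omega
    · rw [h5] at h3; omega
  · rintro ⟨h, hh⟩
    refine ⟨h, ?_, fun p hp hp' => ?_⟩
    · rintro rfl; omega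
    · have h1 := ((treeLE_iff hG r).1 hp).1
      have h2 := ((treeLE_iff hG r).1 hp').1
      rcases Nat.eq_or_lt_of_le h1 with h3 | h3
      · exact Or.inl (eq_of_treeLE hG r hp h3).symm
      · exact Or.inr (eq_of_treeLE hG r hp' (by omega))

/-- Chains of a finite rooted tree that are maximal consist of all vertices below some vertex. -/
theorem exists_end_of_isBranch [Finite V] (hG : G.IsTree) (r : V) {b : Set V} (hb : IsBranch G r b)
    (hne : b.Nonempty) :
    ∃ t, b = {s | TreeLE G r s t} := by
  obtain ⟨t, ht, hmax⟩ := Set.exists_max_image b (height hG r) (Set.toFinite b) hne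
  refine ⟨t, hb.2 ?_ ?_⟩
  · intro s hs s' hs' _
    rcases le_total (height hG r s) (height hG r s') with h | h
    · exact Or.inl (treeLE_of_treeLE hG r hs hs' h)
    · exact Or.inr (treeLE_of_treeLE hG r hs' hs h)
  · intro s hs
    rcases eq_or_ne s t with rfl | hst
    · exact treeLE_refl hG r s
    rcases hb.1 hs ht hst with h | h
    · exact h
    · rw [← eq_of_treeLE hG r h (((treeLE_iff hG r).1 h).1.antisymm (hmax s hs))]
      exact treeLE_refl hG r t

theorem encard_setOf_treeLE (hG : G.IsTree) (r t : V) :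
    {s | TreeLE G r s t}.encard = height hG r t + 1 := by
  have h : {s | TreeLE G r s t} = ancestor hG r t '' {j | j < height hG r t + 1} := by
    ext s
    constructor
    · intro h
      have h := (treeLE_iff hG r).1 h
      exact ⟨_, Nat.lt_succ_of_le h.1, h.2⟩
    · rintro ⟨j, hj, rfl⟩
      exact treeLE_ancestor hG r (Nat.le_of_lt_succ hj)
  rw [h, Set.InjOn.encard_image]
  · rw [Nat.encard_range]
    rfl
  · intro i hi j hj hij
    rw [← height_ancestor hG r (Nat.le_of_lt_succ hi), hij,
      height_ancestor hG r (Nat.le_of_lt_succ hj)]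

variable {r : V}

/-- A vertex of a fan other than the root has at most one immediate successor. -/
theorem eq_of_isImmediateSuccessor (hF : IsFan G r) {s t t' : V} (hs : s ≠ r)
    (h : IsImmediateSuccessor G r s t) (h' : IsImmediateSuccessor G r s t') : t = t' := by
  have hG := hF.1
  by_contra hne
  rw [isImmediateSuccessor_iff hG, treeLE_iff hG] at h h'
  have hpos : 0 < height hG r s := by
    refine Nat.pos_of_ne_zero fun h0 => hs ?_
    rw [← ancestor_height hG r s, h0, ancestor_zero]
  have hadj : ∀ {t}, height hG r t = height hG r s + 1 → ancestor hG r t (height hG r s) = s →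
      G.Adj s t := fun {t} h1 h2 => by
    have := adj_ancestor hG r (t := t) (j := height hG r s) (by omega)
    rwa [h2, ← h1, ancestor_height] at this
  set p := ancestor hG r s (height hG r s - 1) with hp
  have hph : height hG r p = height hG r s - 1 := height_ancestor hG r (by omega)
  have hadjp : G.Adj s p := by
    have := adj_ancestor hG r (t := s) (j := height hG r s - 1) (by omega)
    rw [Nat.sub_add_cancel hpos, ancestor_height] at this
    exact this.symm
  have hsub : ({p, t, t'} : Set V) ⊆ G.neighborSet s := by
    rintro x (rfl | rfl | rfl)
    exacts [hadjp, hadj h.2 h.1.2, hadj h'.2 h'.1.2]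
  have hcard : ({p, t, t'} : Set V).encard = 3 := by
    rw [Set.encard_insert_of_notMem, Set.encard_pair hne]
    · rfl
    · rintro (h1 | h1)
      · rw [h1] at hph; omega
      · rw [Set.mem_singleton_iff.1 h1] at hph; omega
  have := (hcard ▸ Set.encard_le_encard hsub).trans (hF.2 s hs)
  exact absurd this (by decide)

/-- Two vertices of a fan of the same height are equal if they lie above a common vertex other
than the root. -/
theorem eq_of_treeLE_treeLE (hF : IsFan G r) {s t t' : V} (hs : s ≠ r) (h : TreeLE G r s t)
    (h' : TreeLE G r s t') (hh : height hF.1 r t = height hF.1 r t') : t = t' := by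
  have hG := hF.1
  have key : ∀ j, height hG r s + j ≤ height hG r t →
      ancestor hG r t (height hG r s + j) = ancestor hG r t' (height hG r s + j) := by
    intro j
    induction j with
    | zero =>
      intro _
      rw [Nat.add_zero, ((treeLE_iff hG r).1 h).2, ((treeLE_iff hG r).1 h').2]
    | succ j ih =>
      intro hj
      have h1 := ih (by omega)
      have hsucc : ∀ {t}, height hG r s + (j + 1) ≤ height hG r t → IsImmediateSuccessor G r
          (ancestor hG r t (height hG r s + j)) (ancestor hG r t (height hG r s + (j + 1))) := by
        intro t hj
        rw [isImmediateSuccessor_iff hG, height_ancestor hG r hj, height_ancestor hG r (by omega)]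
        refine ⟨treeLE_of_treeLE hG r (treeLE_ancestor hG r (by omega))
          (treeLE_ancestor hG r hj) ?_, rfl⟩
        rw [height_ancestor hG r hj, height_ancestor hG r (by omega)]
        omega
      refine eq_of_isImmediateSuccessor hF (s := ancestor hG r t (height hG r s + j)) ?_
        (hsucc hj) (h1 ▸ hsucc (hh ▸ hj))
      intro h2
      have h3 := height_ancestor hG r (show height hG r s + j ≤ height hG r t by omega)
      have hr : height hG r r = 0 := by
        have := height_ancestor hG r (t := s) (Nat.zero_le _)
        rwa [ancestor_zero] at this
      rw [h2, hr] at h3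
      refine hs ?_
      rw [← ancestor_height hG r s, show height hG r s = 0 by omega, ancestor_zero]
  have h1 := ((treeLE_iff hG r).1 h).1
  have := key (height hG r t - height hG r s) (by omega)
  rwa [Nat.add_sub_cancel' h1, ancestor_height, show height hG r t = height hG r t' from hh,
    ancestor_height] at this

end RootedTree


/-! ### The finite ordered fans are the standard ones -/

namespace StdFan

variable {n k : ℕ}

/-- The height of a vertex of the standard fan. -/
def lev : StdFan n k → ℕ
  | root => 0
  | node _ j => j.val + 1

theorem R_iff (x y : StdFan n k) : RS.R x y ↔ x = y ∨ (Le x y ∧ lev y = lev x + 1) := by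
  cases x <;> cases y <;> simp [lev, Fin.ext_iff]; omega

theorem Le.eq_of_lev {x y : StdFan n k} (h : Le x y) (h' : lev x = lev y) : x = y := by
  cases x <;> cases y <;> simp_all [lev, Fin.ext_iff]

end StdFan

open StdFan in
/-- Every finite ordered fan is isomorphic to a standard one. -/
theorem IsOrderedFan.exists_iso {A : Type} [RS A] [Finite A] (hA : IsOrderedFan A) :
    ∃ (n k : ℕ) (E : A ≃ StdFan n k), 0 < n ∧ (∀ x y, RS.R (E x) (E y) ↔ RS.R x y) ∧
      ∀ x y, RS.S (E x) (E y) ↔ RS.S x y := by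
  obtain ⟨G, r, hF, ⟨k, hk⟩, hR, n, a, ha, hbr, hS⟩ := hA
  have hG := hF.1
  have hne : ∀ i, (a i).Nonempty := fun i => by
    rw [← Set.encard_ne_zero, hk _ ((hbr _).2 ⟨i, rfl⟩)]
    simp
  choose t ht using fun i => exists_end_of_isBranch hG r ((hbr _).2 ⟨i, rfl⟩) (hne i)
  have hmem : ∀ {i s}, s ∈ a i ↔ TreeLE G r s (t i) := fun {i s} => by
    constructor
    · intro h; rw [ht i] at h; exact h
    · intro h; rw [ht i]; exact h
  have htk : ∀ i, height hG r (t i) = k := fun i => by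
    have h := hk _ ((hbr _).2 ⟨i, rfl⟩)
    rw [ht i, encard_setOf_treeLE hG] at h
    have h' : ((height hG r (t i) + 1 : ℕ) : ℕ∞) = ((k + 1 : ℕ) : ℕ∞) := by exact_mod_cast h
    have := Nat.cast_injective h'
    omega
  have htinj : ∀ {i i'}, t i = t i' → i = i' := fun {i i'} h => ha (by rw [ht i, ht i', h])
  have hr0 : height hG r r = 0 := by
    have := height_ancestor hG r (t := r) (Nat.zero_le _)
    rwa [ancestor_zero] at this
  have hne0 : ∀ {s}, s ≠ r ↔ height hG r s ≠ 0 := fun {s} => by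
    refine not_congr ⟨fun h => h ▸ hr0, fun h => ?_⟩
    rw [← ancestor_height hG r s, h, ancestor_zero]
  have hrle : ∀ s, TreeLE G r r s := fun s => by
    rw [treeLE_iff hG, hr0]
    exact ⟨Nat.zero_le _, ancestor_zero hG r s⟩
  -- every vertex lies on a branch
  have hcov : ∀ s, ∃ i, s ∈ a i := fun s => by
    obtain ⟨M, hM, hsM⟩ := (IsChain.singleton (r := TreeLE G r) (a := s)).exists_maxChain
    obtain ⟨i, rfl⟩ := (hbr M).1 hM
    exact ⟨i, hsM rfl⟩
  obtain ⟨F, hF0, hF1⟩ : ∃ F : StdFan n k → A, F root = r ∧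
      ∀ i j, F (node i j) = ancestor hG r (t i) (j.val + 1) :=
    ⟨fun | root => r | node i j => ancestor hG r (t i) (j.val + 1), rfl, fun _ _ => rfl⟩
  have hFh : ∀ x, height hG r (F x) = lev x := by
    rintro (_ | ⟨i, j⟩)
    · rw [hF0]; exact hr0
    · rw [hF1]; exact height_ancestor hG r (by rw [htk]; exact j.2)
  have hFt : ∀ i j, TreeLE G r (F (node i j)) (t i) := fun i j => by
    rw [hF1]
    exact treeLE_ancestor hG r (by rw [htk]; exact j.2)
  have hFt' : ∀ {i j i'}, TreeLE G r (F (node i j)) (t i') → i = i' := fun {i j i'} h =>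
    htinj (eq_of_treeLE_treeLE hF (hne0.2 (by rw [hFh]; exact Nat.succ_ne_zero _)) (hFt i j) h
      (by rw [htk, htk]))
  have hLe : ∀ x y, TreeLE G r (F x) (F y) ↔ Le x y := by
    rintro (_ | ⟨i, j⟩) (_ | ⟨i', j'⟩)
    · exact iff_of_true (hF0 ▸ hrle _) trivial
    · exact iff_of_true (hF0 ▸ hrle _) trivial
    · refine iff_of_false (fun h => ?_) id
      have := ((treeLE_iff hG r).1 h).1
      rw [hFh, hFh] at this
      exact absurd this (by simp [lev])
    · constructor
      · intro h
        refine ⟨hFt' (treeLE_trans hG r h (hFt _ _)), ?_⟩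
        have := ((treeLE_iff hG r).1 h).1
        rw [hFh, hFh] at this
        exact Nat.le_of_succ_le_succ this
      · rintro ⟨rfl, h⟩
        refine treeLE_of_treeLE hG r (hFt _ _) (hFt _ _) ?_
        rw [hFh, hFh]
        exact Nat.succ_le_succ h
  have hinj : Function.Injective F := fun x y h =>
    ((hLe x y).1 (h ▸ treeLE_refl hG r _)).antisymm ((hLe y x).1 (h ▸ treeLE_refl hG r _))
  have hsurj : Function.Surjective F := fun s => by
    obtain ⟨i, hi⟩ := hcov s
    have h := (treeLE_iff hG r).1 (hmem.1 hi)
    rw [htk] at h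
    by_cases h0 : s = r
    · exact ⟨root, hF0.trans h0.symm⟩
    · have := hne0.1 h0
      refine ⟨node i ⟨height hG r s - 1, by omega⟩, ?_⟩
      rw [hF1, Nat.sub_add_cancel (Nat.pos_of_ne_zero this), h.2]
  have hFR : ∀ x y, RS.R (F x) (F y) ↔ RS.R x y := fun x y => by
    rw [hR, isImmediateSuccessor_iff hG, hLe, hFh, hFh, R_iff, hinj.eq_iff]
  have hFS : ∀ x y, RS.S (F x) (F y) ↔ RS.S x y := fun x y => by
    rw [hS]
    obtain ⟨i₀, -⟩ := hcov r
    simp only [hmem]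
    rcases x with _ | ⟨i, j⟩ <;> rcases y with _ | ⟨i', j'⟩
    · exact iff_of_true ⟨i₀, i₀, le_rfl, hF0 ▸ hrle _, hF0 ▸ hrle _⟩ trivial
    · exact iff_of_true ⟨i', i', le_rfl, hF0 ▸ hrle _, hFt _ _⟩ trivial
    · exact iff_of_true ⟨i, i, le_rfl, hFt _ _, hF0 ▸ hrle _⟩ trivial
    · constructor
      · rintro ⟨c, c', hc, h, h'⟩
        rw [← hFt' h, ← hFt' h'] at hc
        exact hc
      · intro h
        exact ⟨i, i', h, hFt _ _, hFt _ _⟩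
  have hFb : Function.Bijective F := ⟨hinj, hsurj⟩
  refine ⟨n, k, (Equiv.ofBijective F hFb).symm, (hcov r).choose.pos, fun x y => ?_,
    fun x y => ?_⟩
  · obtain ⟨x, rfl⟩ := hsurj x
    obtain ⟨y, rfl⟩ := hsurj y
    rw [hFR, Equiv.ofBijective_symm_apply_apply, Equiv.ofBijective_symm_apply_apply]
  · obtain ⟨x, rfl⟩ := hsurj x
    obtain ⟨y, rfl⟩ := hsurj y
    rw [hFS, Equiv.ofBijective_symm_apply_apply, Equiv.ofBijective_symm_apply_apply]

namespace StdFan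

variable (n k : ℕ)

/-- The underlying graph of the standard fan. -/
def graph : SimpleGraph (StdFan n k) := SimpleGraph.fromRel RS.R

variable {n k}

theorem graph_adj {x y : StdFan n k} : (graph n k).Adj x y ↔ x ≠ y ∧ RSymm x y :=
  SimpleGraph.fromRel_adj _ _ _

/-- A vertex has at most one neighbour that is not higher than itself, its predecessor. -/
theorem eq_of_adj_of_lev_le {x y z : StdFan n k} (hy : (graph n k).Adj x y)
    (hz : (graph n k).Adj x z) (hyl : lev y ≤ lev x) (hzl : lev z ≤ lev x) : y = z := by
  rw [graph_adj] at hy hz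
  have key : ∀ {y}, x ≠ y → RSymm x y → lev y ≤ lev x → Le y x ∧ lev x = lev y + 1 := by
    intro y hne h hl
    rcases h with h | h
    · rcases (R_iff _ _).1 h with h | h
      · exact absurd h hne
      · omega
    · rcases (R_iff _ _).1 h with h | h
      · exact absurd h.symm hne
      · exact h
  have h1 := key hy.1 hy.2 hyl
  have h2 := key hz.1 hz.2 hzl
  rcases h1.1.total_of_le h2.1 with h | h
  · exact h.eq_of_lev (by omega)
  · exact (h.eq_of_lev (by omega)).symm

/-- A highest vertex of a cycle would have two neighbours that are not higher. -/
theorem isAcyclic_graph : (graph n k).IsAcyclic := by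
  classical
  intro v c hc
  obtain ⟨u, hu, hmax⟩ := c.support.toFinset.exists_max_image lev
    ⟨v, List.mem_toFinset.2 c.start_mem_support⟩
  rw [List.mem_toFinset] at hu
  have hc' := hc.rotate hu
  have hmax' : ∀ w ∈ (c.rotate u hu).support, lev w ≤ lev u := fun w hw =>
    hmax w (List.mem_toFinset.2 ((SimpleGraph.Walk.mem_support_rotate_iff c u hu).1 hw))
  refine hc'.snd_ne_penultimate (eq_of_adj_of_lev_le
    (SimpleGraph.Walk.adj_snd hc'.not_nil) (SimpleGraph.Walk.adj_penultimate hc'.not_nil).symm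
    (hmax' _ (SimpleGraph.Walk.getVert_mem_support _ _))
    (hmax' _ (SimpleGraph.Walk.getVert_mem_support _ _)))

/-- A path from the root passes exactly through the vertices below its endpoint. -/
theorem exists_path (t : StdFan n k) : ∃ p : (graph n k).Walk root t, p.IsPath ∧
    p.length = lev t ∧ ∀ s, s ∈ p.support ↔ Le s t := by
  have h0 : ∃ p : (graph n k).Walk root root, p.IsPath ∧
      p.length = lev (root : StdFan n k) ∧ ∀ s, s ∈ p.support ↔ Le s root := by
    refine ⟨.nil, .nil, rfl, fun s => ?_⟩
    rw [SimpleGraph.Walk.support_nil, List.mem_singleton]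
    exact ⟨fun h => h ▸ Le.refl _, fun h => h.antisymm trivial⟩
  have step : ∀ s t : StdFan n k, RS.R s t → s ≠ t →
      (∃ p : (graph n k).Walk root s, p.IsPath ∧
        p.length = lev s ∧ ∀ x, x ∈ p.support ↔ Le x s) →
      ∃ p : (graph n k).Walk root t, p.IsPath ∧
        p.length = lev t ∧ ∀ x, x ∈ p.support ↔ Le x t := by
    rintro s t h hne ⟨p, hp, hpl, hps⟩
    refine ⟨p.concat (graph_adj.2 ⟨hne, Or.inl h⟩), hp.concat ?_ _, ?_, fun x => ?_⟩
    · rw [hps]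
      exact fun h' => hne ((Le_of_R h).antisymm h')
    · rw [SimpleGraph.Walk.length_concat, hpl]
      exact (((R_iff _ _).1 h).resolve_left hne).2.symm
    · rw [SimpleGraph.Walk.support_concat, List.mem_append, hps,
        List.mem_singleton]
      constructor
      · rintro (h' | rfl)
        · exact h'.trans (Le_of_R h)
        · exact Le.refl _
      · intro h'
        exact (h'.eq_or_le_of_R h).symm
  rcases t with _ | ⟨i, ⟨j, hj⟩⟩
  · exact h0
  · induction j with
    | zero => exact step root _ rfl (by simp) h0
    | succ j ih => exact step (node i ⟨j, by omega⟩) _ ⟨rfl, Or.inr rfl⟩ (by simp) (ih _)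

theorem isTree_graph : (graph n k).IsTree := by
  have hr : ∀ t, (graph n k).Reachable root t := fun t => ⟨(exists_path t).choose⟩
  have : Nonempty (StdFan n k) := ⟨root⟩
  exact ⟨⟨fun s t => (hr s).symm.trans (hr t)⟩, isAcyclic_graph⟩

theorem treeLE_graph {s t : StdFan n k} : TreeLE (graph n k) root s t ↔ Le s t := by
  obtain ⟨p, hp, -, hps⟩ := exists_path t
  constructor
  · rintro ⟨q, hq, hs⟩
    rwa [(isTree_graph.existsUnique_path root t).unique hq hp, hps] at hs
  · exact fun h => ⟨p, hp, (hps s).2 h⟩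

/-- The branches of the standard fan. -/
def branch (i : Fin n) : Set (StdFan n k) := {x | ∀ i' j, x = node i' j → i' = i}

theorem node_mem_branch {i i' : Fin n} {j : Fin k} : node i j ∈ branch i' ↔ i = i' := by
  simp only [branch, mem_ofPred_eq, node.injEq]
  exact ⟨fun h => h i j ⟨rfl, rfl⟩, fun h a b hab => hab.1 ▸ h⟩

theorem root_mem_branch {i : Fin n} : (root : StdFan n k) ∈ branch i := by
  simp [branch]

theorem isBranch_iff (hn : 0 < n) (hk : 0 < k) {b : Set (StdFan n k)} :
    IsBranch (graph n k) root b ↔ b ∈ range (branch : Fin n → Set (StdFan n k)) := by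
  have hLe : (TreeLE (graph n k) root) = Le := by
    ext s t; exact treeLE_graph
  rw [IsBranch, hLe]
  have hchain : ∀ i : Fin n, IsChain Le (branch i : Set (StdFan n k)) := by
    rintro i (_ | ⟨a, j⟩) hx (_ | ⟨a', j'⟩) hy _
    · exact Or.inl trivial
    · exact Or.inl trivial
    · exact Or.inr trivial
    · rw [node_mem_branch] at hx hy
      subst hx hy
      exact (le_total j j').imp (fun h => ⟨rfl, h⟩) fun h => ⟨rfl, h⟩
  have hsub : ∀ c : Set (StdFan n k), IsChain Le c → ∃ i : Fin n, c ⊆ branch i := by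
    intro c hc
    by_cases h : ∃ i j, node i j ∈ c
    · obtain ⟨i, j, h⟩ := h
      refine ⟨i, ?_⟩
      rintro (_ | ⟨a, j'⟩) hx
      · exact root_mem_branch
      · rw [node_mem_branch]
        by_contra hne
        rcases hc hx h (fun h' => hne (node.inj h').1) with h' | h'
        · exact hne h'.1
        · exact hne h'.1.symm
    · refine ⟨⟨0, hn⟩, ?_⟩
      rintro (_ | ⟨a, j'⟩) hx
      · exact root_mem_branch
      · exact absurd ⟨a, j', hx⟩ h
  constructor
  · rintro ⟨hc, hmax⟩
    obtain ⟨i, hi⟩ := hsub b hc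
    exact ⟨i, (hmax (hchain i) hi).symm⟩
  · rintro ⟨i, rfl⟩
    refine ⟨hchain i, fun c hc hic => hic.antisymm ?_⟩
    obtain ⟨i', hi'⟩ := hsub c hc
    have : i = i' := node_mem_branch.1 (hi' (hic ((node_mem_branch (j := ⟨0, hk⟩)).2 rfl)))
    rwa [this]

theorem encard_branch (i : Fin n) : (branch i : Set (StdFan n k)).encard = k + 1 := by
  have h : (branch i : Set (StdFan n k)) = insert root (range (node i)) := by
    ext x
    rcases x with _ | ⟨a, j⟩
    · simp [root_mem_branch]
    · simp [node_mem_branch, eq_comm]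
  rw [h, Set.encard_insert_of_notMem (by simp), ← image_univ,
    (show Function.Injective (node i : Fin k → StdFan n k) from
      fun a b h => (node.inj h).2).encard_image, Set.encard_univ]
  simp

theorem isOrderedFan (hn : 0 < n) (hk : 0 < k) : IsOrderedFan (StdFan n k) := by
  refine ⟨graph n k, root, ⟨isTree_graph, ?_⟩, ⟨k, fun b hb => ?_⟩, fun s t => ?_, n, branch, ?_,
    fun b => isBranch_iff hn hk, fun x y => ?_⟩
  · rintro (_ | ⟨i, ⟨j, hj⟩⟩) hv
    · exact absurd rfl hv
    · have hsub : (graph n k).neighborSet (node i ⟨j, hj⟩) ⊆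
          {atHeight i j, atHeight i (j + 2)} := by
        rintro (_ | ⟨i', ⟨j', hj'⟩⟩) hx
        · rcases (graph_adj.1 hx).2 with h | h
          · exact h.elim
          · have h : j = 0 := h
            subst h
            exact Or.inl (atHeight_zero i).symm
        · obtain ⟨hne, h⟩ := graph_adj.1 hx
          have h : i = i' ∧ (j' = j + 1 ∨ j = j' + 1) := by
            rcases h with ⟨rfl, h⟩ | ⟨rfl, h⟩
            all_goals
              simp only at h
              simp only [ne_eq, node.injEq, Fin.mk.injEq, true_and] at hne
              exact ⟨rfl, by omega⟩
          obtain ⟨rfl, rfl | rfl⟩ := h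
          · exact Or.inr (atHeight_succ i ⟨j + 1, hj'⟩).symm
          · exact Or.inl (atHeight_succ i ⟨j', hj'⟩).symm
      exact (Set.encard_le_encard hsub).trans
        ((Set.encard_insert_le _ _).trans_eq (by rw [Set.encard_singleton]; rfl))
  · obtain ⟨i, rfl⟩ := (isBranch_iff hn hk).1 hb
    exact encard_branch i
  · have hh : ∀ s : StdFan n k, height isTree_graph root s = lev s := by
      intro s
      obtain ⟨p, hp, hpl, -⟩ := exists_path s
      rw [height, ← eq_rootPath isTree_graph root hp, hpl]
    rw [R_iff, isImmediateSuccessor_iff isTree_graph, treeLE_graph, hh, hh]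
  · intro i i' h
    have h' : node i ⟨0, hk⟩ ∈ branch i' := h ▸ node_mem_branch.2 rfl
    exact node_mem_branch.1 h'
  · rcases x with _ | ⟨i, j⟩ <;> rcases y with _ | ⟨i', j'⟩
    · exact iff_of_true trivial ⟨⟨0, hn⟩, ⟨0, hn⟩, le_rfl, root_mem_branch, root_mem_branch⟩
    · exact iff_of_true trivial ⟨i', i', le_rfl, root_mem_branch, node_mem_branch.2 rfl⟩
    · exact iff_of_true trivial ⟨i, i, le_rfl, node_mem_branch.2 rfl, root_mem_branch⟩
    · simp only [node_mem_branch, S_node_node]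
      exact ⟨fun h => ⟨i, i', h, rfl, rfl⟩, by rintro ⟨c, c', h, rfl, rfl⟩; exact h⟩

end StdFan


/-! ### Epimorphisms from the projective Fraïssé limit onto standard fans -/

section Epimorphisms

theorem RSymm.symm {X : Type*} [RS X] {x y : X} (h : RSymm x y) : RSymm y x := Or.symm h

theorem IsEpimorphism.comp {X Y Z : Type*} [TopologicalSpace X] [RS X] [TopologicalSpace Y] [RS Y]
    [TopologicalSpace Z] [RS Z] {g : Y → Z} {f : X → Y} (hg : IsEpimorphism g)
    (hf : IsEpimorphism f) : IsEpimorphism (g ∘ f) where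
  continuous := hg.continuous.comp hf.continuous
  surjective := hg.surjective.comp hf.surjective
  map_R z₁ z₂ := by
    rw [hg.map_R]
    constructor
    · rintro ⟨y₁, y₂, rfl, rfl, h⟩
      obtain ⟨x₁, x₂, rfl, rfl, h'⟩ := (hf.map_R _ _).1 h
      exact ⟨x₁, x₂, rfl, rfl, h'⟩
    · rintro ⟨x₁, x₂, rfl, rfl, h⟩
      exact ⟨f x₁, f x₂, rfl, rfl, (hf.map_R _ _).2 ⟨x₁, x₂, rfl, rfl, h⟩⟩
  map_S z₁ z₂ := by
    rw [hg.map_S]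
    constructor
    · rintro ⟨y₁, y₂, rfl, rfl, h⟩
      obtain ⟨x₁, x₂, rfl, rfl, h'⟩ := (hf.map_S _ _).1 h
      exact ⟨x₁, x₂, rfl, rfl, h'⟩
    · rintro ⟨x₁, x₂, rfl, rfl, h⟩
      exact ⟨f x₁, f x₂, rfl, rfl, (hf.map_S _ _).2 ⟨x₁, x₂, rfl, rfl, h⟩⟩

theorem IsEpimorphism.of_comp {X Y Z : Type*} [TopologicalSpace X] [RS X] [TopologicalSpace Y]
    [DiscreteTopology Y] [RS Y] [TopologicalSpace Z] [RS Z] {g : Y → Z} {f : X → Y}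
    (hgf : IsEpimorphism (g ∘ f)) (hf : IsEpimorphism f) : IsEpimorphism g where
  continuous := continuous_of_discreteTopology
  surjective := hgf.surjective.of_comp
  map_R z₁ z₂ := by
    rw [hgf.map_R]
    constructor
    · rintro ⟨x₁, x₂, rfl, rfl, h⟩
      exact ⟨f x₁, f x₂, rfl, rfl, (hf.map_R _ _).2 ⟨x₁, x₂, rfl, rfl, h⟩⟩
    · rintro ⟨y₁, y₂, rfl, rfl, h⟩
      obtain ⟨x₁, x₂, rfl, rfl, h'⟩ := (hf.map_R _ _).1 h
      exact ⟨x₁, x₂, rfl, rfl, h'⟩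
  map_S z₁ z₂ := by
    rw [hgf.map_S]
    constructor
    · rintro ⟨x₁, x₂, rfl, rfl, h⟩
      exact ⟨f x₁, f x₂, rfl, rfl, (hf.map_S _ _).2 ⟨x₁, x₂, rfl, rfl, h⟩⟩
    · rintro ⟨y₁, y₂, rfl, rfl, h⟩
      obtain ⟨x₁, x₂, rfl, rfl, h'⟩ := (hf.map_S _ _).1 h
      exact ⟨x₁, x₂, rfl, rfl, h'⟩

theorem isEpimorphism_of_equiv {X Y : Type*} [TopologicalSpace X] [DiscreteTopology X] [RS X]
    [TopologicalSpace Y] [RS Y] (E : X ≃ Y) (hR : ∀ x y, RS.R (E x) (E y) ↔ RS.R x y)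
    (hS : ∀ x y, RS.S (E x) (E y) ↔ RS.S x y) : IsEpimorphism E where
  continuous := continuous_of_discreteTopology
  surjective := E.surjective
  map_R y₁ y₂ := by
    constructor
    · intro h
      refine ⟨E.symm y₁, E.symm y₂, E.apply_symm_apply _, E.apply_symm_apply _, ?_⟩
      rwa [← hR, E.apply_symm_apply, E.apply_symm_apply]
    · rintro ⟨x₁, x₂, rfl, rfl, h⟩
      exact (hR _ _).2 h
  map_S y₁ y₂ := by
    constructor
    · intro h
      refine ⟨E.symm y₁, E.symm y₂, E.apply_symm_apply _, E.apply_symm_apply _, ?_⟩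
      rwa [← hS, E.apply_symm_apply, E.apply_symm_apply]
    · rintro ⟨x₁, x₂, rfl, rfl, h⟩
      exact (hS _ _).2 h

variable {X Y : Type*} [TopologicalSpace X] [RS X] [TopologicalSpace Y] [RS Y]

theorem IsEpimorphism.R {φ : X → Y} (hφ : IsEpimorphism φ) {x y : X} (h : RS.R x y) :
    RS.R (φ x) (φ y) :=
  (hφ.map_R _ _).2 ⟨x, y, rfl, rfl, h⟩

theorem IsEpimorphism.S {φ : X → Y} (hφ : IsEpimorphism φ) {x y : X} (h : RS.S x y) :
    RS.S (φ x) (φ y) :=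
  (hφ.map_S _ _).2 ⟨x, y, rfl, rfl, h⟩

theorem IsEpimorphism.RSymm {φ : X → Y} (hφ : IsEpimorphism φ) {x y : X} (h : RSymm x y) :
    RSymm (φ x) (φ y) :=
  h.imp hφ.R hφ.R

variable {n k m l : ℕ}

theorem IsEpimorphism.map_root {β : StdFan m l → StdFan n k} (hβ : IsEpimorphism β) :
    β .root = .root := by
  have key : ∀ y, StdFan.Le (β .root) (β y) := by
    rintro (_ | ⟨i, ⟨j, hj⟩⟩)
    · exact StdFan.Le.refl _
    · induction j with
      | zero => exact StdFan.Le_of_R (hβ.R rfl)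
      | succ j ih =>
        refine (ih (by omega)).trans (StdFan.Le_of_R (hβ.R ?_))
        exact ⟨rfl, Or.inr rfl⟩
  obtain ⟨c, hc⟩ := hβ.surjective .root
  exact (hc ▸ key c).antisymm trivial

theorem IsEpimorphism.Le {β : StdFan m l → StdFan n k} (hβ : IsEpimorphism β) {x y : StdFan m l}
    (h : StdFan.Le x y) : StdFan.Le (β x) (β y) :=
  StdFan.map_Le (fun _ _ => hβ.R) hβ.map_root h

end Epimorphisms

/-- An epimorphism onto a nontrivial standard fan. -/
structure FanEpi (X : Type u) [TopologicalSpace X] [RS X] where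
  /-- The number of branches. -/
  n : ℕ
  /-- The height. -/
  k : ℕ
  n_pos : 0 < n
  k_pos : 0 < k
  /-- The underlying map. -/
  map : X → StdFan n k
  isEpi : IsEpimorphism map

namespace FanEpi

variable {X : Type u} [TopologicalSpace X] [RS X]

/-- `ψ.Refines φ` means that `φ` factors through `ψ`. -/
def Refines (ψ φ : FanEpi X) : Prop := ∃ β, IsEpimorphism β ∧ φ.map = β ∘ ψ.map

theorem Refines.eq {ψ φ : FanEpi X} (h : ψ.Refines φ) {x y : X} (hxy : ψ.map x = ψ.map y) :
    φ.map x = φ.map y := by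
  obtain ⟨β, -, h⟩ := h
  rw [h, Function.comp_apply, Function.comp_apply, hxy]

theorem Refines.root {ψ φ : FanEpi X} (h : ψ.Refines φ) {x : X} (hx : ψ.map x = .root) :
    φ.map x = .root := by
  obtain ⟨β, hβ, h⟩ := h
  rw [h, Function.comp_apply, hx, hβ.map_root]

theorem Refines.R {ψ φ : FanEpi X} (h : ψ.Refines φ) {x y : X} (hxy : RS.R (ψ.map x) (ψ.map y)) :
    RS.R (φ.map x) (φ.map y) := by
  obtain ⟨β, hβ, h⟩ := h
  rw [h]
  exact hβ.R hxy

theorem Refines.S {ψ φ : FanEpi X} (h : ψ.Refines φ) {x y : X} (hxy : RS.S (ψ.map x) (ψ.map y)) :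
    RS.S (φ.map x) (φ.map y) := by
  obtain ⟨β, hβ, h⟩ := h
  rw [h]
  exact hβ.S hxy

theorem Refines.Le {ψ φ : FanEpi X} (h : ψ.Refines φ) {x y : X}
    (hxy : StdFan.Le (ψ.map x) (ψ.map y)) : StdFan.Le (φ.map x) (φ.map y) := by
  obtain ⟨β, hβ, h⟩ := h
  rw [h]
  exact hβ.Le hxy

end FanEpi

/-- The tree order of the limit, the inverse limit of the tree orders of the standard fans. -/
def Below {X : Type u} [TopologicalSpace X] [RS X] (x y : X) : Prop :=
  ∀ φ : FanEpi X, StdFan.Le (φ.map x) (φ.map y)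

/-- The root of the limit lies over the roots of all standard fans. -/
def IsRoot {X : Type u} [TopologicalSpace X] [RS X] (x : X) : Prop :=
  ∀ φ : FanEpi X, φ.map x = .root

namespace IsProjectiveFraisseLimit

variable {X : Type u} [TopologicalSpace X] [RS X]

/-- The standard fan as a finite structure. -/
abbrev stdStructure (n k : ℕ) : FiniteStructure := ⟨StdFan n k, inferInstance, inferInstance⟩

theorem exists_epi (hX : IsProjectiveFraisseLimit orderedFans X) {n k : ℕ} (hn : 0 < n)
    (hk : 0 < k) : ∃ φ : X → StdFan n k, IsEpimorphism φ :=
  hX.universal (stdStructure n k) (StdFan.isOrderedFan hn hk)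

theorem homogeneous (hX : IsProjectiveFraisseLimit orderedFans X) {n k : ℕ} (hn : 0 < n)
    (hk : 0 < k) {φ₁ φ₂ : X → StdFan n k} (h₁ : IsEpimorphism φ₁) (h₂ : IsEpimorphism φ₂) :
    ∃ ψ : X → X, IsIsomorphism ψ ∧ φ₂ = φ₁ ∘ ψ :=
  hX.ultrahomogeneous (stdStructure n k) (StdFan.isOrderedFan hn hk) φ₁ φ₂ h₁ h₂

/-- The extension property: epimorphisms from the limit lift along epimorphisms of standard
fans. -/
theorem exists_lift (hX : IsProjectiveFraisseLimit orderedFans X) (φ : FanEpi X) {m l : ℕ}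
    (hm : 0 < m) (hl : 0 < l) {β : StdFan m l → StdFan φ.n φ.k} (hβ : IsEpimorphism β) :
    ∃ ψ : X → StdFan m l, IsEpimorphism ψ ∧ φ.map = β ∘ ψ := by
  obtain ⟨χ, hχ⟩ := hX.exists_epi hm hl
  obtain ⟨ψ, hψ, h⟩ := hX.homogeneous φ.n_pos φ.k_pos (hβ.comp hχ) φ.isEpi
  exact ⟨χ ∘ ψ, hχ.comp hψ.1, h⟩

/-- Continuous maps to finite discrete spaces factor through epimorphisms onto nontrivial standard
fans. -/
theorem exists_factor (hX : IsProjectiveFraisseLimit orderedFans X) {Y : Type} [Finite Y]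
    [TopologicalSpace Y] [DiscreteTopology Y] {f : X → Y} (hf : Continuous f) :
    ∃ (φ : FanEpi X) (f₀ : StdFan φ.n φ.k → Y), f = f₀ ∘ φ.map := by
  -- pairing `f` with an epimorphism onto a nontrivial fan excludes the fan of height zero
  obtain ⟨χ, hχ⟩ := hX.exists_epi one_pos one_pos
  obtain ⟨A, hA, φ, hφ, f₀, hf₀⟩ := hX.factor (Y × StdFan 1 1) (fun x => (f x, χ x))
    (hf.prodMk hχ.continuous)
  obtain ⟨n, k, E, hn, hER, hES⟩ := IsOrderedFan.exists_iso hA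
  have hk : 0 < k := by
    rcases Nat.eq_zero_or_pos k with rfl | hk
    · have hsub : ∀ x : StdFan n 0, x = .root := by
        rintro (_ | ⟨i, j⟩)
        · rfl
        · exact j.elim0
      obtain ⟨x, hx⟩ := hχ.surjective .root
      obtain ⟨y, hy⟩ := hχ.surjective (.node 0 0)
      have h : φ x = φ y := E.injective ((hsub _).trans (hsub _).symm)
      have hx' := congrArg Prod.snd (congrFun hf₀ x)
      have hy' := congrArg Prod.snd (congrFun hf₀ y)
      simp only [Function.comp_apply] at hx' hy'
      rw [h, ← hy', hx, hy] at hx'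
      cases hx'
    · exact hk
  refine ⟨⟨n, k, hn, hk, E ∘ φ, (isEpimorphism_of_equiv E hER hES).comp hφ⟩,
    fun a => (f₀ (E.symm a)).1, funext fun x => ?_⟩
  have := congrArg Prod.fst (congrFun hf₀ x)
  simpa using this

theorem exists_refines₂ (hX : IsProjectiveFraisseLimit orderedFans X) (φ₁ φ₂ : FanEpi X) :
    ∃ ψ : FanEpi X, ψ.Refines φ₁ ∧ ψ.Refines φ₂ := by
  obtain ⟨ψ, f₀, h⟩ := hX.exists_factor (f := fun x => (φ₁.map x, φ₂.map x))
    (φ₁.isEpi.continuous.prodMk φ₂.isEpi.continuous)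
  have h₁ : φ₁.map = (fun a => (f₀ a).1) ∘ ψ.map := funext fun x => congrArg Prod.fst (congrFun h x)
  have h₂ : φ₂.map = (fun a => (f₀ a).2) ∘ ψ.map := funext fun x => congrArg Prod.snd (congrFun h x)
  exact ⟨ψ, ⟨_, (h₁ ▸ φ₁.isEpi).of_comp ψ.isEpi, h₁⟩, ⟨_, (h₂ ▸ φ₂.isEpi).of_comp ψ.isEpi, h₂⟩⟩

theorem exists_halve (hX : IsProjectiveFraisseLimit orderedFans X) (φ : FanEpi X) :
    ∃ ψ : X → StdFan φ.n (2 * φ.k + 1), IsEpimorphism ψ ∧ φ.map = StdFan.halve ∘ ψ :=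
  hX.exists_lift φ φ.n_pos (Nat.succ_pos _) (StdFan.isEpimorphism_halve φ.k_pos)

theorem exists_truncate (hX : IsProjectiveFraisseLimit orderedFans X) (φ : FanEpi X) :
    ∃ ψ : X → StdFan (φ.n * (φ.k + 1)) φ.k, IsEpimorphism ψ ∧ φ.map = StdFan.truncate ∘ ψ :=
  hX.exists_lift φ (Nat.mul_pos φ.n_pos (Nat.succ_pos _)) φ.k_pos
    (StdFan.isEpimorphism_truncate φ.k_pos)

theorem nonempty_fanEpi (hX : IsProjectiveFraisseLimit orderedFans X) : Nonempty (FanEpi X) :=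
  ⟨⟨1, 1, one_pos, one_pos, _, (hX.exists_epi one_pos one_pos).choose_spec⟩⟩

/-- If one of two properties holds over each fan, and both are inherited by coarser fans, then
one of them holds over all fans. -/
theorem forall_or_forall (hX : IsProjectiveFraisseLimit orderedFans X) {P Q : FanEpi X → Prop}
    (hP : ∀ φ ψ : FanEpi X, ψ.Refines φ → P ψ → P φ)
    (hQ : ∀ φ ψ : FanEpi X, ψ.Refines φ → Q ψ → Q φ) (h : ∀ φ, P φ ∨ Q φ) :
    (∀ φ, P φ) ∨ ∀ φ, Q φ := by
  by_contra! hne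
  obtain ⟨⟨φ₁, h₁⟩, φ₂, h₂⟩ := hne
  obtain ⟨ψ, hψ₁, hψ₂⟩ := hX.exists_refines₂ φ₁ φ₂
  exact (h ψ).elim (fun h => h₁ (hP _ _ hψ₁ h)) fun h => h₂ (hQ _ _ hψ₂ h)

/-- Compactness: closed conditions that become stronger over finer fans have a common solution if
they are solvable over arbitrarily fine fans. -/
theorem exists_forall_mem (hX : IsProjectiveFraisseLimit orderedFans X) {Z : Type*}
    [TopologicalSpace Z] [CompactSpace Z] (T : FanEpi X → Set Z) (hcl : ∀ φ, IsClosed (T φ))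
    (hanti : ∀ φ ψ : FanEpi X, ψ.Refines φ → T ψ ⊆ T φ) (φ₀ : FanEpi X)
    (hne : ∀ ψ : FanEpi X, ψ.Refines φ₀ → (T ψ).Nonempty) : ∃ z, ∀ φ, z ∈ T φ := by
  have : Nonempty (FanEpi X) := ⟨φ₀⟩
  have h := IsCompact.nonempty_iInter_of_directed_nonempty_isCompact_isClosed T
    (fun φ₁ φ₂ => by
      obtain ⟨ψ, h₁, h₂⟩ := hX.exists_refines₂ φ₁ φ₂
      exact ⟨ψ, hanti _ _ h₁, hanti _ _ h₂⟩)
    (fun φ => by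
      obtain ⟨ψ, h₁, h₂⟩ := hX.exists_refines₂ φ φ₀
      exact (hne ψ h₂).mono (hanti _ _ h₁))
    (fun φ => (hcl φ).isCompact) hcl
  obtain ⟨z, hz⟩ := h
  exact ⟨z, mem_iInter.1 hz⟩

theorem exists_of_isClopen (hX : IsProjectiveFraisseLimit orderedFans X) {U : Set X}
    (hU : IsClopen U) : ∃ (φ : FanEpi X) (P : StdFan φ.n φ.k → Prop), ∀ x, x ∈ U ↔ P (φ.map x) := by
  obtain ⟨φ, f₀, h⟩ := hX.exists_factor ((continuous_boolIndicator_iff_isClopen U).2 hU)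
  refine ⟨φ, fun a => f₀ a = true, fun x => ?_⟩
  rw [Set.mem_iff_boolIndicator, h]
  rfl

variable [CompactSpace X] [T2Space X] [TotallyDisconnectedSpace X]

/-- Every neighbourhood of a point contains a fibre through this point. -/
theorem exists_fiber_subset (hX : IsProjectiveFraisseLimit orderedFans X) {x : X} {U : Set X}
    (hU : IsOpen U) (hx : x ∈ U) : ∃ φ : FanEpi X, ∀ y, φ.map y = φ.map x → y ∈ U := by
  obtain ⟨V, hV, hxV, hVU⟩ := compact_exists_isClopen_in_isOpen hU hx
  obtain ⟨φ, P, hP⟩ := hX.exists_of_isClopen hV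
  refine ⟨φ, fun y hy => hVU ?_⟩
  rw [hP, hy, ← hP]
  exact hxV

theorem exists_map_ne (hX : IsProjectiveFraisseLimit orderedFans X) {x y : X} (h : x ≠ y) :
    ∃ φ : FanEpi X, φ.map x ≠ φ.map y := by
  obtain ⟨φ, hφ⟩ := hX.exists_fiber_subset (isOpen_compl_singleton (x := y)) h
  exact ⟨φ, fun h' => hφ y h'.symm rfl⟩

theorem eq_of_forall_map_eq (hX : IsProjectiveFraisseLimit orderedFans X) {x y : X}
    (h : ∀ φ : FanEpi X, φ.map x = φ.map y) : x = y := by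
  by_contra hne
  obtain ⟨φ, hφ⟩ := hX.exists_map_ne hne
  exact hφ (h φ)

/-- The relation `R` is the inverse limit of the relations of the standard fans. -/
theorem R_iff_forall (hX : IsProjectiveFraisseLimit orderedFans X) {x y : X} :
    RS.R x y ↔ ∀ φ : FanEpi X, RS.R (φ.map x) (φ.map y) := by
  refine ⟨fun h φ => φ.isEpi.R h, fun h => ?_⟩
  obtain ⟨φ₀⟩ := hX.nonempty_fanEpi
  obtain ⟨p, hp⟩ := hX.exists_forall_mem
    (fun φ => {p : X × X | RS.R p.1 p.2} ∩ (fun p => (φ.map p.1, φ.map p.2)) ⁻¹'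
      {(φ.map x, φ.map y)})
    (fun φ => hX.isTopologicalStructure.isClosed_R.inter ((isClosed_discrete _).preimage
      ((φ.isEpi.continuous.comp continuous_fst).prodMk (φ.isEpi.continuous.comp continuous_snd))))
    (fun φ ψ hψ p hp => ⟨hp.1, Prod.ext (hψ.eq (congrArg Prod.fst hp.2))
      (hψ.eq (congrArg Prod.snd hp.2))⟩) φ₀
    (fun ψ _ => by
      obtain ⟨x', y', hx, hy, hR⟩ := (ψ.isEpi.map_R _ _).1 (h ψ)
      exact ⟨(x', y'), hR, Prod.ext hx hy⟩)
  rw [← hX.eq_of_forall_map_eq fun φ => congrArg Prod.fst (hp φ).2,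
    ← hX.eq_of_forall_map_eq fun φ => congrArg Prod.snd (hp φ).2]
  exact (hp φ₀).1

theorem S_iff_forall (hX : IsProjectiveFraisseLimit orderedFans X) {x y : X} :
    RS.S x y ↔ ∀ φ : FanEpi X, RS.S (φ.map x) (φ.map y) := by
  refine ⟨fun h φ => φ.isEpi.S h, fun h => ?_⟩
  obtain ⟨φ₀⟩ := hX.nonempty_fanEpi
  obtain ⟨p, hp⟩ := hX.exists_forall_mem
    (fun φ => {p : X × X | RS.S p.1 p.2} ∩ (fun p => (φ.map p.1, φ.map p.2)) ⁻¹'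
      {(φ.map x, φ.map y)})
    (fun φ => hX.isTopologicalStructure.isClosed_S.inter ((isClosed_discrete _).preimage
      ((φ.isEpi.continuous.comp continuous_fst).prodMk (φ.isEpi.continuous.comp continuous_snd))))
    (fun φ ψ hψ p hp => ⟨hp.1, Prod.ext (hψ.eq (congrArg Prod.fst hp.2))
      (hψ.eq (congrArg Prod.snd hp.2))⟩) φ₀
    (fun ψ _ => by
      obtain ⟨x', y', hx, hy, hS⟩ := (ψ.isEpi.map_S _ _).1 (h ψ)
      exact ⟨(x', y'), hS, Prod.ext hx hy⟩)
  rw [← hX.eq_of_forall_map_eq fun φ => congrArg Prod.fst (hp φ).2,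
    ← hX.eq_of_forall_map_eq fun φ => congrArg Prod.snd (hp φ).2]
  exact (hp φ₀).1

end IsProjectiveFraisseLimit

/-! ### The tree order and the root of the limit -/

section TreeOrder

variable {X : Type u} [TopologicalSpace X] [RS X]

theorem Below.refl (x : X) : Below x x := fun _ => StdFan.Le.refl _

theorem Below.trans {x y z : X} (h : Below x y) (h' : Below y z) : Below x z :=
  fun φ => (h φ).trans (h' φ)

theorem Below.of_R {x y : X} (h : RS.R x y) : Below x y := fun φ => StdFan.Le_of_R (φ.isEpi.R h)

theorem IsRoot.below {r : X} (hr : IsRoot r) (x : X) : Below r x := fun φ => by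
  rw [hr φ]; trivial

namespace IsProjectiveFraisseLimit

theorem exists_isRoot (hX : IsProjectiveFraisseLimit orderedFans X) [CompactSpace X] :
    ∃ r : X, IsRoot r := by
  obtain ⟨φ₀⟩ := hX.nonempty_fanEpi
  exact hX.exists_forall_mem (fun φ => φ.map ⁻¹' {StdFan.root})
    (fun φ => (isClosed_discrete _).preimage φ.isEpi.continuous)
    (fun _ _ h x hx => mem_singleton_iff.2 (h.root (mem_singleton_iff.1 hx))) φ₀
    fun ψ _ => ψ.isEpi.surjective _

theorem below_total_of_below (hX : IsProjectiveFraisseLimit orderedFans X) {x y z : X}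
    (hx : Below x z) (hy : Below y z) : Below x y ∨ Below y x :=
  hX.forall_or_forall (fun _ _ h => h.Le) (fun _ _ h => h.Le) fun φ => (hx φ).total_of_le (hy φ)

theorem below_or_below_of_S (hX : IsProjectiveFraisseLimit orderedFans X) {x y : X}
    (h : RS.S x y) (h' : RS.S y x) : Below x y ∨ Below y x :=
  hX.forall_or_forall (fun _ _ h => h.Le) (fun _ _ h => h.Le) fun φ =>
    StdFan.Le_or_of_S (φ.isEpi.S h) (φ.isEpi.S h')

variable [CompactSpace X] [T2Space X] [TotallyDisconnectedSpace X]

theorem isRoot_unique (hX : IsProjectiveFraisseLimit orderedFans X) {x y : X}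
    (hx : IsRoot x) (hy : IsRoot y) : x = y :=
  hX.eq_of_forall_map_eq fun φ => (hx φ).trans (hy φ).symm

theorem R_refl (hX : IsProjectiveFraisseLimit orderedFans X) (x : X) : RS.R x x :=
  hX.R_iff_forall.2 fun _ => StdFan.R_refl _

theorem S_total (hX : IsProjectiveFraisseLimit orderedFans X) (x y : X) :
    RS.S x y ∨ RS.S y x := by
  rw [hX.S_iff_forall, hX.S_iff_forall]
  exact hX.forall_or_forall (fun _ _ h => h.S) (fun _ _ h => h.S) fun φ => StdFan.S_total _ _

theorem S_of_below (hX : IsProjectiveFraisseLimit orderedFans X) {x y : X} (h : Below x y) :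
    RS.S x y ∧ RS.S y x :=
  ⟨hX.S_iff_forall.2 fun φ => (h φ).S.1, hX.S_iff_forall.2 fun φ => (h φ).S.2⟩

/-- A point strictly below `z` lies below the immediate predecessor of `z`. -/
theorem eq_or_below_of_R (hX : IsProjectiveFraisseLimit orderedFans X) {x y z : X}
    (h : Below x z) (hR : RS.R y z) : x = z ∨ Below x y := by
  rcases hX.forall_or_forall (P := fun φ => φ.map x = φ.map z)
    (Q := fun φ => StdFan.Le (φ.map x) (φ.map y)) (fun _ _ h => h.eq) (fun _ _ h => h.Le)
    (fun φ => (h φ).eq_or_le_of_R (φ.isEpi.R hR)) with h | h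
  · exact Or.inl (hX.eq_of_forall_map_eq h)
  · exact Or.inr h

/-- A point is related by the symmetrization of `R` to at most one other point: over a fan where
three points are distinct, halving the fan separates the neighbours of the middle one. -/
theorem eq_of_RSymm_of_RSymm (hX : IsProjectiveFraisseLimit orderedFans X) {x y z : X}
    (hxy : RSymm x y) (hyz : RSymm y z) (hx : x ≠ y) (hz : z ≠ y) : x = z := by
  by_contra hxz
  obtain ⟨φ₁, h₁⟩ := hX.exists_map_ne hx
  obtain ⟨φ₂, h₂⟩ := hX.exists_map_ne hz
  obtain ⟨φ₃, h₃⟩ := hX.exists_map_ne hxz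
  obtain ⟨φ₄, h₄, h₄'⟩ := hX.exists_refines₂ φ₁ φ₂
  obtain ⟨φ, h₅, h₅'⟩ := hX.exists_refines₂ φ₃ φ₄
  obtain ⟨ψ, hψ, h⟩ := hX.exists_halve φ
  have h₁ : φ.map x ≠ φ.map y := fun h => h₁ (h₄.eq (h₅'.eq h))
  have h₂ : φ.map z ≠ φ.map y := fun h => h₂ (h₄'.eq (h₅'.eq h))
  have h₃ : φ.map x ≠ φ.map z := fun h => h₃ (h₅.eq h)
  rw [h] at h₁ h₂ h₃
  exact h₃ (StdFan.halve_eq_of_RSymm (hψ.RSymm hxy) (hψ.RSymm hyz) h₁ h₂)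

theorem eq_of_RSymm_of_isRoot (hX : IsProjectiveFraisseLimit orderedFans X) {r y : X}
    (hr : IsRoot r) (h : RSymm r y) : y = r := by
  refine hX.isRoot_unique (fun φ => ?_) hr
  obtain ⟨ψ, hψ, hφ⟩ := hX.exists_halve φ
  rw [hφ]
  exact StdFan.eq_root_of_halve_eq (hr ⟨_, _, φ.n_pos, Nat.succ_pos _, ψ, hψ⟩) (hψ.RSymm h)

theorem equivalence_RSymm (hX : IsProjectiveFraisseLimit orderedFans X) :
    Equivalence (RSymm (X := X)) where
  refl x := Or.inl (hX.R_refl x)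
  symm := RSymm.symm
  trans {x y z} hxy hyz := by
    by_cases hx : x = y
    · rwa [hx]
    by_cases hz : z = y
    · rwa [hz]
    rw [hX.eq_of_RSymm_of_RSymm hxy hyz hx hz]
    exact Or.inl (hX.R_refl z)

/-- The relation `S` is invariant under the symmetrization of `R`: distinct related points lie on
the same branch, as neither is the root. -/
theorem S_congr (hX : IsProjectiveFraisseLimit orderedFans X) {x x' y : X} (h : RSymm x x') :
    (RS.S x y → RS.S x' y) ∧ (RS.S y x → RS.S y x') := by
  rcases eq_or_ne x x' with rfl | hne
  · exact ⟨id, id⟩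
  have hx : ¬ IsRoot x := fun hx => hne (hX.eq_of_RSymm_of_isRoot hx h).symm
  have hx' : ¬ IsRoot x' := fun hx => hne (hX.eq_of_RSymm_of_isRoot hx h.symm)
  simp only [IsRoot, not_forall] at hx hx'
  obtain ⟨φ₁, h₁⟩ := hx
  obtain ⟨φ₂, h₂⟩ := hx'
  obtain ⟨φ₃, h₃, h₃'⟩ := hX.exists_refines₂ φ₁ φ₂
  have key : ∀ φ : FanEpi X, ∃ ψ : FanEpi X, ψ.Refines φ ∧
      (RS.S (ψ.map x) (ψ.map y) ↔ RS.S (ψ.map x') (ψ.map y)) ∧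
      (RS.S (ψ.map y) (ψ.map x) ↔ RS.S (ψ.map y) (ψ.map x')) := fun φ => by
    obtain ⟨ψ, hψ, hψ'⟩ := hX.exists_refines₂ φ φ₃
    exact ⟨ψ, hψ, StdFan.S_congr_of_RSymm (ψ.isEpi.RSymm h) (fun h => h₁ (h₃.root (hψ'.root h)))
      fun h => h₂ (h₃'.root (hψ'.root h))⟩
  constructor
  · refine fun hS => hX.S_iff_forall.2 fun φ => ?_
    obtain ⟨ψ, hψ, h, -⟩ := key φ
    exact hψ.S (h.1 (ψ.isEpi.S hS))
  · refine fun hS => hX.S_iff_forall.2 fun φ => ?_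
    obtain ⟨ψ, hψ, -, h⟩ := key φ
    exact hψ.S (h.1 (ψ.isEpi.S hS))

/-- The root is the only point that precedes and succeeds all points in the order of branches. -/
theorem isRoot_iff (hX : IsProjectiveFraisseLimit orderedFans X) {x : X} :
    IsRoot x ↔ ∀ y, RS.S x y ∧ RS.S y x := by
  refine ⟨fun h y => hX.S_of_below (h.below y), fun h φ => ?_⟩
  -- a fan with at least two branches is needed here
  obtain ⟨ψ, hψ, hφ⟩ := hX.exists_truncate φ
  have hk := φ.k_pos
  have hpos : 1 < φ.n * (φ.k + 1) := by nlinarith [φ.n_pos]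
  rw [hφ, Function.comp_apply]
  rcases hx : ψ x with _ | ⟨i, j⟩
  · rfl
  · have key : ∀ i', i' = i := fun i' => by
      obtain ⟨y, hy⟩ := hψ.surjective (.node i' j)
      have h₁ := hψ.S (h y).1
      have h₂ := hψ.S (h y).2
      rw [hx, hy] at h₁ h₂
      exact le_antisymm h₂ h₁
    have := (key ⟨0, by omega⟩).trans (key ⟨1, hpos⟩).symm
    simp at this

/-- An edge below the image of a point lifts to a pair of related points below this point. -/
theorem exists_R_of_le (hX : IsProjectiveFraisseLimit orderedFans X) (φ : FanEpi X) {t : X}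
    {a a' : StdFan φ.n φ.k} (h : RS.R a a') (ha' : StdFan.Le a' (φ.map t)) :
    ∃ x x', RS.R x x' ∧ Below x t ∧ Below x' t ∧ φ.map x = a ∧ φ.map x' = a' := by
  obtain ⟨p, hp⟩ := hX.exists_forall_mem
    (fun ψ => {p : X × X | RS.R (ψ.map p.1) (ψ.map p.2) ∧ StdFan.Le (ψ.map p.2) (ψ.map t)} ∩
      {p | φ.map p.1 = a ∧ φ.map p.2 = a'})
    (fun ψ => by
      have hc : ∀ ψ : FanEpi X, Continuous fun p : X × X => (ψ.map p.1, ψ.map p.2) := fun ψ =>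
        (ψ.isEpi.continuous.comp continuous_fst).prodMk (ψ.isEpi.continuous.comp continuous_snd)
      exact ((isClosed_discrete {q : _ × _ | RS.R q.1 q.2 ∧ StdFan.Le q.2 (ψ.map t)}).preimage
        (hc ψ)).inter ((isClosed_discrete {q : _ × _ | q.1 = a ∧ q.2 = a'}).preimage (hc φ)))
    (fun ψ₁ ψ₂ hψ p hp => ⟨⟨hψ.R hp.1.1, hψ.Le hp.1.2⟩, hp.2⟩) φ
    (fun ψ hψ => by
      obtain ⟨β, hβ, hφ⟩ := hψ
      obtain ⟨c, c', h₁, h₂, rfl, rfl⟩ := StdFan.exists_lift hβ.map_root (fun _ _ => hβ.R) h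
        (b := ψ.map t) (by rwa [hφ] at ha')
      obtain ⟨x, rfl⟩ := ψ.isEpi.surjective c
      obtain ⟨x', rfl⟩ := ψ.isEpi.surjective c'
      exact ⟨(x, x'), ⟨h₁, h₂⟩, by rw [hφ]; rfl, by rw [hφ]; rfl⟩)
  have hR : RS.R p.1 p.2 := hX.R_iff_forall.2 fun ψ => (hp ψ).1.1
  have hb : Below p.2 t := fun ψ => (hp ψ).1.2
  exact ⟨p.1, p.2, hR, (Below.of_R hR).trans hb, hb, (hp φ).2⟩

theorem exists_below (hX : IsProjectiveFraisseLimit orderedFans X) (φ : FanEpi X) {t : X}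
    {a : StdFan φ.n φ.k} (ha : StdFan.Le a (φ.map t)) : ∃ x, Below x t ∧ φ.map x = a := by
  obtain ⟨x, -, -, h, -, h', -⟩ := hX.exists_R_of_le φ (StdFan.R_refl a) ha
  exact ⟨x, h, h'⟩

end IsProjectiveFraisseLimit

end TreeOrder


/-! ### The quotient space -/

section Projection

variable {X : Type u} [TopologicalSpace X] [RS X] {L : Type v} [TopologicalSpace L]

theorem isQuotientMap_proj (e : FanQuotient X ≃ₜ L) : IsQuotientMap (proj e) :=
  e.isQuotientMap.comp isQuotientMap_quot_mk

theorem exists_proj_eq (e : FanQuotient X ≃ₜ L) (p : L) : ∃ x, proj e x = p :=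
  (isQuotientMap_proj e).surjective p

/-- The tree order of the quotient, the image of the tree order of the limit. -/
def BelowL (e : FanQuotient X ≃ₜ L) (p q : L) : Prop :=
  ∃ s t : X, Below s t ∧ proj e s = p ∧ proj e t = q

theorem isClosed_below (t : X) : IsClosed {s | Below s t} := by
  have h : {s | Below s t} = ⋂ φ : FanEpi X, φ.map ⁻¹' {a | StdFan.Le a (φ.map t)} := by
    ext s
    simp only [mem_iInter]
    rfl
  rw [h]
  exact isClosed_iInter fun φ => (isClosed_discrete _).preimage φ.isEpi.continuous

theorem inducedHomeo_mem_orderPreserving (e : FanQuotient X ≃ₜ L) (h : Aut X) :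
    inducedHomeo e h ∈ orderPreserving e := by
  rintro _ _ ⟨s, t, hst, rfl, rfl⟩
  rw [inducedHomeo_proj, inducedHomeo_proj]
  exact ⟨_, _, (h.2.2 s t).2 hst, rfl, rfl⟩

variable [CompactSpace X] [T2Space X] [TotallyDisconnectedSpace X]

namespace IsProjectiveFraisseLimit

theorem proj_eq_iff (hX : IsProjectiveFraisseLimit orderedFans X) (e : FanQuotient X ≃ₜ L)
    {x y : X} : proj e x = proj e y ↔ RSymm x y :=
  e.injective.eq_iff.trans (hX.equivalence_RSymm.quot_mk_eq_iff x y)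

theorem isClosedMap_proj (hX : IsProjectiveFraisseLimit orderedFans X) (e : FanQuotient X ≃ₜ L) :
    IsClosedMap (proj e) := by
  intro A hA
  rw [← (isQuotientMap_proj e).isClosed_preimage]
  have hR : IsClosed {p : X × X | RSymm p.1 p.2} :=
    hX.isTopologicalStructure.isClosed_R.union
      (hX.isTopologicalStructure.isClosed_R.preimage continuous_swap)
  have h : proj e ⁻¹' (proj e '' A) =
      Prod.snd '' ({p : X × X | RSymm p.1 p.2} ∩ Prod.fst ⁻¹' A) := by
    ext y
    constructor
    · rintro ⟨x, hx, hxy⟩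
      exact ⟨(x, y), ⟨(hX.proj_eq_iff e).1 hxy, hx⟩, rfl⟩
    · rintro ⟨⟨x, y⟩, ⟨hxy, hx⟩, rfl⟩
      exact ⟨x, hx, (hX.proj_eq_iff e).2 hxy⟩
  rw [h]
  exact ((hR.inter (hA.preimage continuous_fst)).isCompact.image continuous_snd).isClosed

theorem t2Space (hX : IsProjectiveFraisseLimit orderedFans X) (e : FanQuotient X ≃ₜ L) :
    T2Space L := by
  have hc := (isQuotientMap_proj e).continuous
  have hcl := hX.isClosedMap_proj e
  have h1 : ∀ p : L, IsClosed (proj e ⁻¹' {p}) := fun p => by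
    obtain ⟨x, rfl⟩ := exists_proj_eq e p
    have := hcl _ (isClosed_singleton (x := x))
    rw [image_singleton] at this
    exact this.preimage hc
  refine ⟨fun p q hpq => ?_⟩
  obtain ⟨U, V, hU, hV, hpU, hqV, hUV⟩ := normal_separation (h1 p) (h1 q)
    (Disjoint.preimage _ (disjoint_singleton.2 hpq))
  refine ⟨(proj e '' Uᶜ)ᶜ, (proj e '' Vᶜ)ᶜ, (hcl _ hU.isClosed_compl).isOpen_compl,
    (hcl _ hV.isClosed_compl).isOpen_compl, ?_, ?_, ?_⟩
  · rintro ⟨x, hx, hxp⟩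
    exact hx (hpU hxp)
  · rintro ⟨x, hx, hxq⟩
    exact hx (hqV hxq)
  · rw [Set.disjoint_left]
    intro z hzU hzV
    obtain ⟨x, rfl⟩ := exists_proj_eq e z
    have hxU : x ∈ U := by by_contra h; exact hzU ⟨x, h, rfl⟩
    have hxV : x ∈ V := by by_contra h; exact hzV ⟨x, h, rfl⟩
    exact Set.disjoint_left.1 hUV hxU hxV

theorem le_proj_iff (hX : IsProjectiveFraisseLimit orderedFans X) (e : FanQuotient X ≃ₜ L)
    {x y : X} : le e (proj e x) (proj e y) ↔ RS.S x y := by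
  constructor
  · rintro ⟨s, t, h, hs, ht⟩
    exact (hX.S_congr ((hX.proj_eq_iff e).1 ht)).2 ((hX.S_congr ((hX.proj_eq_iff e).1 hs)).1 h)
  · exact fun h => ⟨x, y, h, rfl, rfl⟩

theorem isClosed_le (hX : IsProjectiveFraisseLimit orderedFans X) (e : FanQuotient X ≃ₜ L) :
    IsClosed {p : L × L | le e p.1 p.2} := by
  have := hX.t2Space e
  have hc := (isQuotientMap_proj e).continuous
  have h : {p : L × L | le e p.1 p.2} =
      Prod.map (proj e) (proj e) '' {p : X × X | RS.S p.1 p.2} := by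
    ext ⟨p, q⟩
    constructor
    · rintro ⟨s, t, h, rfl, rfl⟩
      exact ⟨(s, t), h, rfl⟩
    · rintro ⟨⟨s, t⟩, h, hst⟩
      exact ⟨s, t, h, congrArg Prod.fst hst, congrArg Prod.snd hst⟩
  rw [h]
  exact (hX.isTopologicalStructure.isClosed_S.isCompact.image (hc.prodMap hc)).isClosed

theorem le_total (hX : IsProjectiveFraisseLimit orderedFans X) (e : FanQuotient X ≃ₜ L)
    (p q : L) : le e p q ∨ le e q p := by
  obtain ⟨x, rfl⟩ := exists_proj_eq e p
  obtain ⟨y, rfl⟩ := exists_proj_eq e q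
  rw [hX.le_proj_iff, hX.le_proj_iff]
  exact hX.S_total x y

/-- Segments of the quotient are connected: a clopen partition of the chain below `t` is visible
over some standard fan, where it separates two neighbours. -/
theorem isPreconnected_segment (hX : IsProjectiveFraisseLimit orderedFans X)
    (e : FanQuotient X ≃ₜ L) (t : X) : IsPreconnected (proj e '' {s | Below s t}) := by
  have := hX.t2Space e
  have hc := (isQuotientMap_proj e).continuous
  rw [isPreconnected_closed_iff]
  intro F F' hF hF' hcov hne hne'
  by_contra hdisj
  rw [Set.not_nonempty_iff_eq_empty] at hdisj
  have hnot : ∀ s, Below s t → proj e s ∈ F → proj e s ∈ F' → False := fun s hs h h' => by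
    have : proj e s ∈ proj e '' {s | Below s t} ∩ (F ∩ F') := ⟨⟨s, hs, rfl⟩, h, h'⟩
    rw [hdisj] at this
    exact this
  have hFG : ∀ s, Below s t → (proj e s ∈ F' ↔ proj e s ∉ F) := fun s hs =>
    ⟨fun h' h => hnot s hs h h', fun h => (hcov ⟨s, hs, rfl⟩).resolve_left h⟩
  obtain ⟨N, hN, hFN, hNF⟩ := exists_clopen_of_closed_subset_open
    (Z := {s | Below s t} ∩ proj e ⁻¹' F) (U := ({s | Below s t} ∩ proj e ⁻¹' F')ᶜ)
    ((isClosed_below t).inter (hF.preimage hc))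
    ((isClosed_below t).inter (hF'.preimage hc)).isOpen_compl
    fun s hs h => hnot s hs.1 hs.2 h.2
  have hN' : ∀ s, Below s t → (s ∈ N ↔ proj e s ∈ F) := fun s hs => by
    constructor
    · intro h
      by_contra h'
      exact hNF h ⟨hs, (hFG s hs).2 h'⟩
    · exact fun h => hFN ⟨hs, h⟩
  obtain ⟨φ, P, hP⟩ := hX.exists_of_isClopen hN
  have key : ∀ a a', RS.R a a' → StdFan.Le a' (φ.map t) → (P a ↔ P a') := by
    intro a a' h ha'
    obtain ⟨x, x', hR, hx, hx', rfl, rfl⟩ := hX.exists_R_of_le φ h ha'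
    rw [← hP, ← hP, hN' x hx, hN' x' hx', (hX.proj_eq_iff e).2 (Or.inl hR)]
  have hroot : ∀ a, StdFan.Le a (φ.map t) → (P .root ↔ P a) := by
    rintro (_ | ⟨i, ⟨j, hj⟩⟩) ha
    · exact Iff.rfl
    · induction j with
      | zero => exact key _ _ (by rfl) ha
      | succ j ih =>
        have hR : RS.R (StdFan.node i ⟨j, by omega⟩) (StdFan.node i ⟨j + 1, hj⟩) :=
          ⟨rfl, Or.inr rfl⟩
        exact (ih (by omega) ((StdFan.Le_of_R hR).trans ha)).trans (key _ _ hR ha)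
  obtain ⟨_, ⟨s, hs, rfl⟩, hsF⟩ := hne
  obtain ⟨_, ⟨s', hs', rfl⟩, hsF'⟩ := hne'
  rw [← hN' s hs, hP, ← hroot _ (hs φ), hroot _ (hs' φ), ← hP, hN' s' hs'] at hsF
  exact hnot s' hs' hsF hsF'

/-- A closed connected set that contains the root and `proj e t` contains the segment between
them: a point of the segment that is missed is separated from the set over some standard fan,
where removing a vertex disconnects the vertices above it from the root. -/
theorem mem_of_isPreconnected (hX : IsProjectiveFraisseLimit orderedFans X)
    (e : FanQuotient X ≃ₜ L) {r s t : X} (hr : IsRoot r) (hst : Below s t) {C : Set L}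
    (hC : IsClosed C) (hCc : IsPreconnected C) (hrC : proj e r ∈ C) (htC : proj e t ∈ C) :
    proj e s ∈ C := by
  have hc := (isQuotientMap_proj e).continuous
  by_contra hs
  obtain ⟨φ, hφ⟩ := hX.exists_fiber_subset (hC.preimage hc).isOpen_compl (x := s) hs
  have hφ' : ∀ x, proj e x ∈ C → φ.map x ≠ φ.map s := fun x hx h => hφ x h hx
  set W : Set X := φ.map ⁻¹' {a | StdFan.Le (φ.map s) a} with hW
  have hWcl : IsClopen W := (isClopen_discrete _).preimage φ.isEpi.continuous
  have hrW : r ∉ W := fun h => hφ' r hrC ((hr.below s φ).antisymm h)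
  rw [isPreconnected_closed_iff] at hCc
  obtain ⟨_, -, ⟨x, ⟨hx, hxC⟩, hxp⟩, y, ⟨hy, -⟩, hyp⟩ := hCc (proj e '' (W ∩ proj e ⁻¹' C))
    (proj e '' (Wᶜ ∩ proj e ⁻¹' C))
    (hX.isClosedMap_proj e _ (hWcl.1.inter (hC.preimage hc)))
    (hX.isClosedMap_proj e _ (hWcl.compl.1.inter (hC.preimage hc)))
    (fun p hp => by
      obtain ⟨x, rfl⟩ := exists_proj_eq e p
      by_cases hx : x ∈ W
      · exact Or.inl ⟨x, ⟨hx, hp⟩, rfl⟩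
      · exact Or.inr ⟨x, ⟨hx, hp⟩, rfl⟩)
    ⟨proj e t, htC, t, ⟨hst φ, htC⟩, rfl⟩
    ⟨proj e r, hrC, r, ⟨hrW, hrC⟩, rfl⟩
  refine hφ' x hxC (StdFan.eq_of_RSymm_of_le (y := φ.map y) (φ.isEpi.RSymm ?_) hx hy)
  exact (hX.proj_eq_iff e).1 (hxp.trans hyp.symm)

/-- A topological description of the tree order of the quotient. -/
theorem belowL_iff (hX : IsProjectiveFraisseLimit orderedFans X) (e : FanQuotient X ≃ₜ L) {r : X}
    (hr : IsRoot r) {p q : L} : BelowL e p q ↔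
      ∀ C : Set L, IsClosed C → IsPreconnected C → proj e r ∈ C → q ∈ C → p ∈ C := by
  constructor
  · rintro ⟨s, t, h, rfl, rfl⟩ C hC hCc hrC htC
    exact hX.mem_of_isPreconnected e hr h hC hCc hrC htC
  · intro h
    obtain ⟨t, rfl⟩ := exists_proj_eq e q
    obtain ⟨s, hs, rfl⟩ := h (proj e '' {s | Below s t})
      (hX.isClosedMap_proj e _ (isClosed_below t)) (hX.isPreconnected_segment e t)
      ⟨r, hr.below t, rfl⟩ ⟨t, Below.refl t, rfl⟩
    exact ⟨s, t, hs, rfl, rfl⟩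

theorem le_of_belowL (hX : IsProjectiveFraisseLimit orderedFans X) (e : FanQuotient X ≃ₜ L)
    {p q : L} (h : BelowL e p q) : le e p q ∧ le e q p := by
  obtain ⟨s, t, h, rfl, rfl⟩ := h
  rw [hX.le_proj_iff, hX.le_proj_iff]
  exact hX.S_of_below h

/-- Homeomorphisms that preserve `≤_L` fix the root, the only point related to all points in both
directions. -/
theorem apply_root (hX : IsProjectiveFraisseLimit orderedFans X) (e : FanQuotient X ≃ₜ L) {r : X}
    (hr : IsRoot r) {h : L ≃ₜ L} (hh : h ∈ orderPreserving e) : h (proj e r) = proj e r := by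
  obtain ⟨s, hs⟩ := exists_proj_eq e (h (proj e r))
  rw [← hs]
  congr 1
  refine hX.isRoot_unique (hX.isRoot_iff.2 fun y => ?_) hr
  obtain ⟨p, hp⟩ := h.surjective (proj e y)
  obtain ⟨z, rfl⟩ := exists_proj_eq e p
  rw [← hX.le_proj_iff e, ← hX.le_proj_iff e, hs, ← hp]
  have := hX.isRoot_iff.1 hr z
  exact ⟨hh _ _ ((hX.le_proj_iff e).2 this.1), hh _ _ ((hX.le_proj_iff e).2 this.2)⟩

/-- The tree order of the quotient is a topological invariant of the quotient with its root. -/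
theorem belowL_apply (hX : IsProjectiveFraisseLimit orderedFans X) (e : FanQuotient X ≃ₜ L)
    {r : X} (hr : IsRoot r) {h : L ≃ₜ L} (hh : h (proj e r) = proj e r) {p q : L}
    (hpq : BelowL e p q) : BelowL e (h p) (h q) := by
  rw [hX.belowL_iff e hr] at *
  intro C hC hCc hrC hqC
  refine hpq (h ⁻¹' C) (hC.preimage h.continuous) ?_ ?_ hqC
  · rwa [h.isPreconnected_preimage]
  · rwa [mem_preimage, hh]

/-- The inverse of a homeomorphism that preserves `≤_L` preserves `≤_L`. -/
theorem symm_mem_orderPreserving (hX : IsProjectiveFraisseLimit orderedFans X)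
    (e : FanQuotient X ≃ₜ L) {h : L ≃ₜ L} (hh : h ∈ orderPreserving e) :
    h.symm ∈ orderPreserving e := by
  intro p q hpq
  refine (hX.le_total e (h.symm p) (h.symm q)).elim id fun h' => ?_
  -- `p` and `q` precede each other, so they lie on a segment, which `h.symm` preserves
  have hqp := hh _ _ h'
  rw [h.apply_symm_apply, h.apply_symm_apply] at hqp
  obtain ⟨r, hr⟩ := hX.exists_isRoot
  have hhr : h.symm (proj e r) = proj e r := by
    rw [h.symm_apply_eq, hX.apply_root e hr hh]
  obtain ⟨x, rfl⟩ := exists_proj_eq e p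
  obtain ⟨y, rfl⟩ := exists_proj_eq e q
  rw [hX.le_proj_iff] at hpq hqp
  rcases hX.below_or_below_of_S hpq hqp with hb | hb
  · exact (hX.le_of_belowL e (hX.belowL_apply e hr hhr ⟨x, y, hb, rfl, rfl⟩)).1
  · exact (hX.le_of_belowL e (hX.belowL_apply e hr hhr ⟨y, x, hb, rfl, rfl⟩)).2

theorem isClosed_orderPreserving (hX : IsProjectiveFraisseLimit orderedFans X)
    (e : FanQuotient X ≃ₜ L) : IsClosed (orderPreserving e) := by
  have hev : ∀ p : L, Continuous fun h : L ≃ₜ L => h p := fun p =>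
    (continuous_eval_const (F := C(L, L)) p).comp
      (continuous_induced_dom (f := fun h : L ≃ₜ L => (h : C(L, L))))
  have h : orderPreserving e =
      ⋂ (p : L) (q : L) (_ : le e p q), {h : L ≃ₜ L | le e (h p) (h q)} := by
    ext h
    simp only [mem_iInter]
    rfl
  rw [h]
  exact isClosed_iInter fun p => isClosed_iInter fun q => isClosed_iInter fun _ =>
    (hX.isClosed_le e).preimage ((hev p).prodMk (hev q))

/-- Each point of the quotient has a lowest representative in the limit. -/
theorem exists_low (hX : IsProjectiveFraisseLimit orderedFans X) (e : FanQuotient X ≃ₜ L) :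
    ∃ low : L → X, (∀ p, proj e (low p) = p) ∧ ∀ x, RS.R (low (proj e x)) x := by
  have key : ∀ p, ∃ y, proj e y = p ∧ ∀ x, proj e x = p → RS.R y x := by
    intro p
    obtain ⟨y, rfl⟩ := exists_proj_eq e p
    by_cases h : ∃ s, s ≠ y ∧ RS.R s y
    · obtain ⟨s, hne, hs⟩ := h
      refine ⟨s, (hX.proj_eq_iff e).2 (Or.inl hs), fun x hx => ?_⟩
      rw [hX.proj_eq_iff] at hx
      by_cases hxy : x = y
      · rwa [hxy]
      · rw [hX.eq_of_RSymm_of_RSymm hx (Or.inr hs) hxy hne]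
        exact hX.R_refl s
    · refine ⟨y, rfl, fun x hx => ?_⟩
      push Not at h
      rcases (hX.proj_eq_iff e).1 hx with h' | h'
      · by_cases hxy : x = y
        · rw [hxy]; exact hX.R_refl y
        · exact absurd h' (h x hxy)
      · exact h'
  choose low h₁ h₂ using key
  exact ⟨low, h₁, fun x => h₂ _ x rfl⟩

/-- Taking the lowest representatives is monotone for the tree orders. -/
theorem below_low (hX : IsProjectiveFraisseLimit orderedFans X) {e : FanQuotient X ≃ₜ L}
    {low : L → X} (hlow : ∀ p, proj e (low p) = p) (hlow' : ∀ x, RS.R (low (proj e x)) x)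
    {p q : L} (h : BelowL e p q) : Below (low p) (low q) := by
  obtain ⟨s, t, hst, rfl, rfl⟩ := h
  rcases hX.eq_or_below_of_R ((Below.of_R (hlow' s)).trans hst) (hlow' t) with h | h
  · have h' : proj e s = proj e t := by rw [← h, hlow]
    rw [h']
    exact Below.refl _
  · exact h

end IsProjectiveFraisseLimit

end Projection


/-! ### Approximation of order-preserving homeomorphisms -/

section Approximation

open Uniformity

/-- A uniformly small motion can only join members of a finite family of compact sets that
intersect. -/
theorem exists_entourage_forall_inter_nonempty {L ι : Type*} [UniformSpace L] [CompactSpace L]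
    [Finite ι] (K : ι → Set L) (hK : ∀ i, IsClosed (K i)) :
    ∃ δ ∈ 𝓤 L, ∀ i j, ∀ p ∈ K i, ∀ q ∈ K j, (p, q) ∈ δ → (K i ∩ K j).Nonempty := by
  have key : ∀ ij : ι × ι, ∃ δ ∈ 𝓤 L, ∀ p ∈ K ij.1, ∀ q ∈ K ij.2, (p, q) ∈ δ →
      (K ij.1 ∩ K ij.2).Nonempty := by
    rintro ⟨i, j⟩
    by_cases h : (K i ∩ K j).Nonempty
    · exact ⟨univ, Filter.univ_mem, fun _ _ _ _ _ => h⟩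
    · obtain ⟨δ, hδ, hd⟩ := (Set.disjoint_iff_inter_eq_empty.2
        (Set.not_nonempty_iff_eq_empty.1 h)).exists_uniform_thickening (hK i).isCompact (hK j)
      refine ⟨δ, hδ, fun p hp q hq hpq => ?_⟩
      have hqj : q ∈ ⋃ x ∈ K j, UniformSpace.ball x δ :=
        mem_biUnion hq (UniformSpace.mem_ball_self q hδ)
      exact absurd hqj (Set.disjoint_left.1 hd (mem_biUnion hp hpq))
  choose δ hδ h using key
  exact ⟨⋂ ij, δ ij, Filter.iInter_mem.2 hδ,
    fun i j p hp q hq hpq => h (i, j) p hp q hq (mem_iInter.1 hpq (i, j))⟩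

namespace IsProjectiveFraisseLimit

variable {X : Type u} [TopologicalSpace X] [RS X]

theorem exists_aut_of_isIsomorphism [CompactSpace X] [T2Space X] {ψ : X → X}
    (hψ : IsIsomorphism ψ) : ∃ f : Aut X, ∀ x, f.1 x = ψ x := by
  let E : X ≃ X := Equiv.ofBijective ψ hψ.2
  have hE : Continuous E := hψ.1.continuous
  refine ⟨⟨hE.homeoOfEquivCompactToT2, fun x y => ?_, fun x y => ?_⟩, fun x => rfl⟩
  · refine ⟨fun h => ?_, fun h => hψ.1.R h⟩
    obtain ⟨x', y', hx, hy, h'⟩ := (hψ.1.map_R _ _).1 h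
    rwa [← hψ.2.1 hx, ← hψ.2.1 hy]
  · refine ⟨fun h => ?_, fun h => hψ.1.S h⟩
    obtain ⟨x', y', hx, hy, h'⟩ := (hψ.1.map_S _ _).1 h
    rwa [← hψ.2.1 hx, ← hψ.2.1 hy]

/-- Over the end of each branch of a fan there is a point all of whose neighbours lie over this
end. -/
theorem exists_interior_end (hX : IsProjectiveFraisseLimit orderedFans X) (φ : FanEpi X)
    (i : Fin φ.n) : ∃ z : X, ∀ (j : Fin φ.k), j.val + 1 = φ.k → ∀ y, RSymm z y →
      φ.map y = .node i j := by
  obtain ⟨ψ, hψ, hφ⟩ := hX.exists_halve φ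
  obtain ⟨z, hz⟩ := hψ.surjective (.node i ⟨2 * φ.k, by omega⟩)
  refine ⟨z, fun j hj y hy => ?_⟩
  have h := hψ.RSymm hy
  rw [hz] at h
  rw [hφ]
  exact StdFan.halve_eq_of_RSymm_end hj rfl h

variable [CompactSpace X] [T2Space X] [TotallyDisconnectedSpace X]

/-- Over a sufficiently fine fan, a continuous map varies arbitrarily little on each fibre. -/
theorem exists_fibers_small (hX : IsProjectiveFraisseLimit orderedFans X) {L : Type v}
    [UniformSpace L] {g : X → L} (hg : Continuous g) {V : Set (L × L)} (hV : V ∈ 𝓤 L) :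
    ∃ φ : FanEpi X, ∀ x y, φ.map x = φ.map y → (g x, g y) ∈ V := by
  by_contra! hne
  obtain ⟨φ₀⟩ := hX.nonempty_fanEpi
  have hgg : Continuous fun p : X × X => (g p.1, g p.2) :=
    (hg.comp continuous_fst).prodMk (hg.comp continuous_snd)
  obtain ⟨p, hp⟩ := hX.exists_forall_mem
    (fun φ => {p : X × X | φ.map p.1 = φ.map p.2} ∩ (fun p => (g p.1, g p.2)) ⁻¹' (interior V)ᶜ)
    (fun φ => (isClosed_eq (φ.isEpi.continuous.comp continuous_fst)
      (φ.isEpi.continuous.comp continuous_snd)).inter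
        (isOpen_interior.isClosed_compl.preimage hgg))
    (fun φ ψ hψ p hp => ⟨hψ.eq hp.1, hp.2⟩) φ₀
    (fun ψ _ => by
      obtain ⟨x, y, h, hxy⟩ := hne ψ
      exact ⟨(x, y), h, fun h' => hxy (interior_subset h')⟩)
  have h : p.1 = p.2 := hX.eq_of_forall_map_eq fun φ => (hp φ).1
  refine (hp φ₀).2 ?_
  show (g p.1, g p.2) ∈ interior V
  rw [h]
  exact refl_mem_uniformity (interior_mem_uniformity hV)

/-- An epimorphism onto a standard fan has a section that is monotone for the tree order and for
the order of branches; each branch is mapped to the chain below a point over its end. -/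
theorem exists_monotone_section (hX : IsProjectiveFraisseLimit orderedFans X) (θ : FanEpi X) :
    ∃ ξ : StdFan θ.n θ.k → X, (∀ b, θ.map (ξ b) = b) ∧ IsRoot (ξ .root) ∧
      (∀ b b', StdFan.Le b b' → Below (ξ b) (ξ b')) ∧ ∀ b b', RS.S b b' → RS.S (ξ b) (ξ b') := by
  have hk := θ.k_pos
  obtain ⟨r, hr⟩ := hX.exists_isRoot
  choose t ht using fun i : Fin θ.n => θ.isEpi.surjective (.node i ⟨θ.k - 1, by omega⟩)
  choose x hxt hx using fun (i : Fin θ.n) (j : Fin θ.k) =>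
    hX.exists_below θ (t := t i) (a := .node i j) (by
      rw [ht]
      refine ⟨rfl, ?_⟩
      have := j.2
      simp only
      omega)
  obtain ⟨ξ, hξ0, hξ1⟩ : ∃ ξ : StdFan θ.n θ.k → X, ξ .root = r ∧ ∀ i j, ξ (.node i j) = x i j :=
    ⟨fun | .root => r | .node i j => x i j, rfl, fun _ _ => rfl⟩
  have hθ : ∀ b, θ.map (ξ b) = b := by
    rintro (_ | ⟨i, j⟩)
    · rw [hξ0, hr θ]
    · rw [hξ1, hx]
  have hLe : ∀ b b', StdFan.Le b b' → Below (ξ b) (ξ b') := by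
    rintro (_ | ⟨i, j⟩) (_ | ⟨i', j'⟩) h
    · exact Below.refl _
    · rw [hξ0]; exact hr.below _
    · exact h.elim
    · obtain ⟨rfl, hj⟩ := h
      rcases hX.below_total_of_below (hxt i j) (hxt i j') with h' | h'
      · rwa [hξ1, hξ1]
      · have h := h' θ
        rw [hx, hx] at h
        rw [show j = j' from Fin.ext (hj.antisymm h.2)]
        exact Below.refl _
  refine ⟨ξ, hθ, hξ0 ▸ hr, hLe, fun b b' h => ?_⟩
  refine (hX.S_total (ξ b) (ξ b')).elim id fun h' => ?_
  have h' := θ.isEpi.S h'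
  rw [hθ, hθ] at h'
  rcases StdFan.Le_or_of_S h h' with h'' | h''
  · exact (hX.S_of_below (hLe _ _ h'')).1
  · exact (hX.S_of_below (hLe _ _ h'')).2

/-- The automorphisms of the limit approximate all homeomorphisms of the quotient that preserve
`≤_L`. -/
theorem exists_aut_close (hX : IsProjectiveFraisseLimit orderedFans X) {L : Type v}
    [UniformSpace L] [CompactSpace L] [T2Space L] (e : FanQuotient X ≃ₜ L) {h : L ≃ₜ L}
    (hh : h ∈ orderPreserving e) {V : Set (L × L)} (hV : V ∈ 𝓤 L) :
    ∃ f : Aut X, ∀ p, (h p, inducedHomeo e f p) ∈ V := by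
  have hc := (isQuotientMap_proj e).continuous
  obtain ⟨V', hV', -, hVV⟩ := comp_symm_of_uniformity hV
  -- `φ` is the fan over which the automorphism is prescribed, `K a` is the piece of `L` over `a`
  obtain ⟨φ, hφ⟩ := hX.exists_fibers_small hc hV'
  choose z hz using hX.exists_interior_end φ
  set K : StdFan φ.n φ.k ⊕ Fin φ.n → Set L :=
    Sum.elim (fun a => proj e '' (φ.map ⁻¹' {a})) fun i => {proj e (z i)} with hK
  obtain ⟨δ, hδ, hδK⟩ := exists_entourage_forall_inter_nonempty K (by
    rintro (a | i)
    · exact hX.isClosedMap_proj e _ ((isClosed_discrete _).preimage φ.isEpi.continuous)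
    · exact isClosed_singleton)
  obtain ⟨δ', hδ', hsymm, hδδ⟩ := comp_symm_of_uniformity (Filter.inter_mem hδ hV')
  have hδ'sub : ∀ {p q}, (p, q) ∈ δ' → (p, q) ∈ δ ∩ V' := fun {p q} hpq =>
    hδδ ⟨q, hpq, refl_mem_uniformity hδ'⟩
  -- `θ` is a finer fan, in which every vertex of a fan that is fine enough for `h ∘ proj e` is the
  -- image of an end
  obtain ⟨θ₀, hθ₀⟩ := hX.exists_fibers_small (h.continuous.comp hc) hδ'
  obtain ⟨θmap, hθepi, hθθ₀⟩ := hX.exists_truncate θ₀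
  let θ : FanEpi X :=
    ⟨_, _, Nat.mul_pos θ₀.n_pos (Nat.succ_pos θ₀.k), θ₀.k_pos, θmap, hθepi⟩
  have hθ : ∀ x y, θ.map x = θ.map y → (h (proj e x), h (proj e y)) ∈ δ' := fun x y hxy =>
    hθ₀ x y (by rw [hθθ₀]; exact congrArg StdFan.truncate hxy)
  obtain ⟨ξ, hξ, hξroot, hξLe, hξS⟩ := hX.exists_monotone_section θ
  obtain ⟨low, hlow, hlow'⟩ := hX.exists_low e
  -- `ρ` picks representatives of the images under `h` of one point over each vertex
  obtain ⟨ρ, hρ⟩ : ∃ ρ : StdFan θ.n θ.k → X, ∀ b, ρ b = low (h (proj e (ξ b))) := ⟨_, fun _ => rfl⟩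
  have hρproj : ∀ b, proj e (ρ b) = h (proj e (ξ b)) := fun b => by rw [hρ, hlow]
  have hroot := hX.apply_root e hξroot hh
  have hρLe : ∀ b b', StdFan.Le b b' → Below (ρ b) (ρ b') := fun b b' hb => by
    rw [hρ, hρ]
    exact hX.below_low hlow hlow'
      (hX.belowL_apply e hξroot hroot ⟨ξ b, ξ b', hξLe b b' hb, rfl, rfl⟩)
  have hmem : ∀ x, proj e x ∈ K (.inl (φ.map x)) := fun x => ⟨x, rfl, rfl⟩
  have hepi : IsEpimorphism (fun b => φ.map (ρ b)) := by
    refine StdFan.isEpimorphism_of_ends φ.k_pos ?_ (fun b b' hb => ?_) (fun b b' hb => ?_)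
      fun i j hj => ?_
    · have hr : RSymm (ξ .root) (ρ .root) := by
        rw [← hX.proj_eq_iff e, hρproj, hroot]
      show φ.map (ρ .root) = .root
      rw [hX.eq_of_RSymm_of_isRoot hξroot hr]
      exact hξroot φ
    · -- the images of adjacent pieces under `h` are close to each other
      refine (hρLe b b' (StdFan.Le_of_R hb) φ).R_of_RSymm ?_
      obtain ⟨x, x', hx, hx', hxx⟩ := (θ.isEpi.map_R _ _).1 hb
      have hxx' : proj e x = proj e x' := (hX.proj_eq_iff e).2 (Or.inl hxx)
      have h₁ := hθ (ξ b) x (by rw [hξ, hx])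
      have h₂ := hθ x' (ξ b') (by rw [hξ, hx'])
      rw [hxx'] at h₁
      have h₃ : (h (proj e (ξ b)), h (proj e (ξ b'))) ∈ δ ∩ V' := hδδ ⟨_, h₁, h₂⟩
      replace h₃ := h₃.1
      rw [← hρproj, ← hρproj] at h₃
      obtain ⟨_, ⟨y, hy, rfl⟩, y', hy', hyy⟩ := hδK _ _ _ (hmem (ρ b)) _ (hmem (ρ b')) h₃
      have h₄ := φ.isEpi.RSymm ((hX.proj_eq_iff e).1 hyy.symm)
      rwa [mem_singleton_iff.1 hy, mem_singleton_iff.1 hy'] at h₄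
    · refine φ.isEpi.S ?_
      rw [← hX.le_proj_iff e, hρproj, hρproj]
      exact hh _ _ ((hX.le_proj_iff e).2 (hξS b b' hb))
    · obtain ⟨p, hp⟩ := h.surjective (proj e (z i))
      obtain ⟨w, rfl⟩ := exists_proj_eq e p
      obtain ⟨i', j', -, hij⟩ := StdFan.exists_end_truncate_eq θ₀.n_pos θ₀.k_pos (θ₀.map w)
      refine ⟨.node i' j', ?_⟩
      have h₁ : (h (proj e (ξ (.node i' j'))), h (proj e w)) ∈ δ' := hθ₀ _ _ (by
        rw [← hij, hθθ₀]
        exact congrArg StdFan.truncate (hξ (.node i' j')))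
      have h₂ := (hδ'sub h₁).1
      rw [← hρproj, hp] at h₂
      obtain ⟨_, ⟨y, hy, rfl⟩, hyz⟩ := hδK _ (.inr i) _ (hmem (ρ (.node i' j'))) _ rfl h₂
      show φ.map (ρ (.node i' j')) = .node i j
      rw [← mem_singleton_iff.1 hy]
      exact hz i j hj y ((hX.proj_eq_iff e).1 (mem_singleton_iff.1 hyz).symm)
  obtain ⟨ψ, hψ, hφψ⟩ := hX.homogeneous φ.n_pos φ.k_pos φ.isEpi (hepi.comp θ.isEpi)
  obtain ⟨f, hf⟩ := exists_aut_of_isIsomorphism hψ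
  refine ⟨f, fun p => ?_⟩
  obtain ⟨x, rfl⟩ := exists_proj_eq e p
  rw [inducedHomeo_proj, hf]
  have h₁ := hθ x (ξ (θ.map x)) (hξ _).symm
  rw [← hρproj] at h₁
  exact hVV ⟨_, (hδ'sub h₁).2, hφ _ _ (congrFun hφψ x)⟩

end IsProjectiveFraisseLimit

end Approximation

end LelekFan

/-- Let `X` be a projective Fraïssé limit of the family of finite ordered fans, let `L` be the
Lelek fan, in the form of any copy of the quotient of `X` by the symmetrization of `R`, and let
`≤_L` be the image of `S`.  Then the closure of the image of `Aut X` in the homeomorphism group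
of `L` is equal to the set of all homeomorphisms that preserve `≤_L`, and this set is a group. -/
theorem proposition7p6 {X : Type u} [TopologicalSpace X] [LelekFan.RS X]
    (hX : LelekFan.IsProjectiveFraisseLimit LelekFan.orderedFans X)
    {L : Type v} [TopologicalSpace L] (e : LelekFan.FanQuotient X ≃ₜ L) :
    LelekFan.closureAut e = LelekFan.orderPreserving e ∧
      ∃ K : Subgroup (L ≃ₜ L), (K : Set (L ≃ₜ L)) = LelekFan.orderPreserving e := by
  have := hX.isTopologicalStructure.compact
  have := hX.isTopologicalStructure.hausdorff
  have := hX.isTopologicalStructure.zeroDimensional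
  have := hX.t2Space e
  have : CompactSpace L := e.compactSpace
  refine ⟨subset_antisymm ?_ fun h hh => ?_, ⟨⟨⟨LelekFan.orderPreserving e, ?_⟩, ?_⟩, ?_⟩, rfl⟩
  · refine closure_minimal ?_ (hX.isClosed_orderPreserving e)
    rintro _ ⟨f, rfl⟩
    exact LelekFan.inducedHomeo_mem_orderPreserving e f
  · -- the compact-open topology is the topology of uniform convergence
    let _ : UniformSpace L := uniformSpaceOfCompactR1
    refine closure_induced.2 ((mem_closure_iff_nhds_basis (nhds_basis_uniformity'
      ContinuousMap.hasBasis_compactConvergenceUniformity_of_compact)).2 fun V hV => ?_)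
    obtain ⟨f, hf⟩ := hX.exists_aut_close e hh hV
    exact ⟨_, ⟨_, ⟨f, rfl⟩, rfl⟩, hf⟩
  · exact fun {f g} hf hg p q hpq => hf _ _ (hg _ _ hpq)
  · exact fun p q hpq => hpq
  · exact fun {f} hf => hX.symm_mem_orderPreserving e hf
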